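/- **Setting.** Let $\Gamma$ be a finite simple graph with vertex set $X$, and let $G$ be the right-angled Artin group with generators $X$ and relations $xy=yx$ for every edge $x-y$ of $\Gamma$. Words are words over the alphabet $X\cup X^{-1}$; a word is positive if it lies in $X^{*}$ (the empty word is positive). Fix a total ordering $<$ of $X\cup X^{-1}$ that orients the four relations of each edge in the same way: for an edge $x-y$, if $y^{\varepsilon}<x^{\gamma}$ for some signs $\gamma,\varepsilon\in\{1,-1\}$, then for all signs. Order words by the induced length-lexicographical ordering. Put $$\Re_0=\{x^{\gamma}y^{\varepsilon}\to y^{\varepsilon}x^{\gamma} : x-y \text{ an edge},\ \gamma,\varepsilon=\pm1,\ y^{\varepsilon}<x^{\gamma}\},\qquad F=\{xx^{-1}\to1,\ x^{-1}x\to 1 : x\in X\}.$$ An overlap of a rule $uv\to r_1$ at left with a rule $vw\to r_2$ at right ($u,v,w$ non-empty) has the overlapped word $uvw$ and the critical pair $(r_1w,\,ur_2)$; it resolves modulo a system $S$ if these two words have a common descendant under $\to_S^{*}$. **Completion.** Start with $S_0=\Re_0\cup F$. At step $n\ge1$ treat, among all overlaps between rules of $S_{n-1}$ not treated at an earlier step,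 all those whose overlapped word is shortest. For each of them, reduce both words of the critical pair to a normal form modulo $S_{n-1}$ (an arbitrary one, if there are several; normal forms are selected by a fixed choice depending only on the system and the word). If the two normal forms differ, the overlap produces the rule from the greater to the smaller one. Let $S_n$ be $S_{n-1}$ together with the rules produced at step $n$, and let $\Re=\bigl(\bigcup_n S_n\bigr)\setminus F$. A rule $ux\to xu$, with $u=t_1t_2\cdots t_k$, $k\ge1$ and $x,t_i\in X\cup X^{-1}$, satisfies the condition on prefixes if $t_1x\to xt_1$ and $xt_i\to t_ix$ ($2\le i\le k$) are rules of $\Re_0$. A system satisfies $C^{+}$ if it has at least one rule with positive left-hand side and every rule with positive left-hand side has a positive right-hand side. **Proposition.** For every such choice of normal forms the following hold. (i) The system $\Re\cup F$ is complete (terminating and confluent) and equivalent to $\Re_0\cup F$; two words are equivalent modulo $\Re\cup F$ if and only if they represent the same element of $G$. Moreover: * (A) Every rule of $\Re$ has the form $ux\to xu$ and satisfies the condition on prefixes. * (B) Every overlap between rules of $\Re\cup F$ is treated at some step. If an overlap treated at step $n$ produces a rule, then its left rule is in $\Re$ and its right rule is in $\Re_0$; every overlap treated at step $n$ that is not of this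 kind (left rule in $\Re$, right rule in $\Re_0$) resolves modulo $S_{n-1}$. * (C) Both sides of every rule of $\Re_0$ have length $2$, and both sides of every rule produced at step $n\ge1$ have length $n+2$. (ii) For every rule of $\Re$, one side is a positive word if and only if the other side is. In particular, if $\Gamma$ has at least one edge, then $\Re$ and $\Re\cup F$ satisfy $C^{+}$ (even if $\Re$ is infinite). -/

import Mathlib

namespace KnuthBendix

/-! ### String rewriting systems -/

/-- A rewriting rule `l → r` over the alphabet `α`, stored as the pair `(l, r)`; words over `α`
are lists, the empty list being the empty word. -/
abbrev Rule (α : Type*) := List α × List α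

/-- One reduction step `p l q → p r q`, for a rule `l → r` of `S`. -/
def Reduces {α : Type*} (S : Set (Rule α)) (a b : List α) : Prop :=
  ∃ p q : List α, ∃ ρ ∈ S, a = p ++ ρ.1 ++ q ∧ b = p ++ ρ.2 ++ q

/-- The reflexive transitive closure `→*` of the reduction relation. -/
def ReducesStar {α : Type*} (S : Set (Rule α)) : List α → List α → Prop :=
  Relation.ReflTransGen (Reduces S)

/-- The equivalence `↔*` generated by the reduction relation. -/
def Equivalent {α : Type*} (S : Set (Rule α)) : List α → List α → Prop :=
  Relation.EqvGen (Reduces S)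

def Irreducible {α : Type*} (S : Set (Rule α)) (w : List α) : Prop :=
  ¬ ∃ z, Reduces S w z

/-- There is no infinite sequence of reductions. -/
def Terminating {α : Type*} (S : Set (Rule α)) : Prop :=
  ¬ ∃ f : ℕ → List α, ∀ n, Reduces S (f n) (f (n + 1))

/-- The words `a` and `b` have a common descendant. -/
def Joinable {α : Type*} (S : Set (Rule α)) (a b : List α) : Prop :=
  ∃ z, ReducesStar S a z ∧ ReducesStar S b z

def Confluent {α : Type*} (S : Set (Rule α)) : Prop :=
  ∀ w a b, ReducesStar S w a → ReducesStar S w b → Joinable S a b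

def Complete {α : Type*} (S : Set (Rule α)) : Prop :=
  Terminating S ∧ Confluent S

/-! ### Overlap ambiguities -/

/-- The data of an overlap of a rule `uv → r₁` at left with a rule `vw → r₂` at right. -/
structure Overlap (α : Type*) where
  u : List α
  v : List α
  w : List α
  r₁ : List α
  r₂ : List α

/-- The rule `uv → r₁` at left. -/
def Overlap.left {α : Type*} (o : Overlap α) : Rule α := (o.u ++ o.v, o.r₁)

/-- The rule `vw → r₂` at right. -/
def Overlap.right {α : Type*} (o : Overlap α) : Rule α := (o.v ++ o.w, o.r₂)

/-- The length of the overlapped word `uvw`. -/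
def Overlap.length {α : Type*} (o : Overlap α) : ℕ := (o.u ++ o.v ++ o.w).length

/-- The first word `r₁w` of the critical pair. -/
def Overlap.crit₁ {α : Type*} (o : Overlap α) : List α := o.r₁ ++ o.w

/-- The second word `ur₂` of the critical pair. -/
def Overlap.crit₂ {α : Type*} (o : Overlap α) : List α := o.u ++ o.r₂

/-- `o` is an overlap ambiguity of the system `S`. -/
def Overlap.IsIn {α : Type*} (o : Overlap α) (S : Set (Rule α)) : Prop :=
  o.u ≠ [] ∧ o.v ≠ [] ∧ o.w ≠ [] ∧ o.left ∈ S ∧ o.right ∈ S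

/-- The critical pair of the overlap `o` resolves by means of `S`. -/
def Overlap.Resolves {α : Type*} (o : Overlap α) (S : Set (Rule α)) : Prop :=
  Joinable S o.crit₁ o.crit₂

/-! ### The completion procedure -/

/-- `nf S w` is a normal form of `w` modulo `S`, for every system `S` all of whose rules decrease
strictly in the length-lexicographical ordering induced by `lt`. Such a system need not be
confluent, so a word may have several normal forms; `nf` selects one of them. -/
def IsNormalizer {α : Type*} (lt : α → α → Prop)
    (nf : Set (Rule α) → List α → List α) : Prop :=
  ∀ S : Set (Rule α), (∀ ρ ∈ S, List.Shortlex lt ρ.2 ρ.1) →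
    ∀ w, ReducesStar S w (nf S w) ∧ Irreducible S (nf S w)

/-- A state of the procedure: the rules obtained so far and the overlaps already treated. -/
structure State (α : Type*) where
  rules : Set (Rule α)
  treated : Set (Overlap α)

/-- The overlaps between the present rules that have not been treated yet. -/
def State.pending {α : Type*} (s : State α) : Set (Overlap α) :=
  {o | o.IsIn s.rules ∧ o ∉ s.treated}

/-- The overlaps to be treated next: all pending ones whose overlapped word is shortest. -/
def State.next {α : Type*} (s : State α) : Set (Overlap α) :=
  {o | o ∈ s.pending ∧ ∀ o' ∈ s.pending, o.length ≤ o'.length}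

/-- The overlap `o` produces the rule `ρ` over `S`: the normal forms modulo `S` of the two words
of its critical pair are different, and `ρ` rewrites the greater one to the smaller one. -/
def Produces {α : Type*} (lt : α → α → Prop) (nf : Set (Rule α) → List α → List α)
    (S : Set (Rule α)) (o : Overlap α) (ρ : Rule α) : Prop :=
  List.Shortlex lt ρ.2 ρ.1 ∧
    (ρ = (nf S o.crit₁, nf S o.crit₂) ∨ ρ = (nf S o.crit₂, nf S o.crit₁))

/-- The rules produced by the overlaps to be treated next. -/
def State.newRules {α : Type*} (lt : α → α → Prop) (nf : Set (Rule α) → List α → List α)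
    (s : State α) : Set (Rule α) :=
  {ρ | ∃ o ∈ s.next, Produces lt nf s.rules o ρ}

/-- One step of the completion. -/
def State.step {α : Type*} (lt : α → α → Prop) (nf : Set (Rule α) → List α → List α)
    (s : State α) : State α where
  rules := s.rules ∪ s.newRules lt nf
  treated := s.treated ∪ s.next

/-- The state after `n` steps of the completion of the system `S₀`. -/
def run {α : Type*} (lt : α → α → Prop) (nf : Set (Rule α) → List α → List α)
    (S₀ : Set (Rule α)) : ℕ → State α
  | 0 => ⟨S₀, ∅⟩
  | n + 1 => (run lt nf S₀ n).step lt nf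

/-- The (possibly infinite) system obtained by the completion of `S₀`. -/
def completion {α : Type*} (lt : α → α → Prop) (nf : Set (Rule α) → List α → List α)
    (S₀ : Set (Rule α)) : Set (Rule α) :=
  ⋃ n, (run lt nf S₀ n).rules

end KnuthBendix

namespace RightAngledArtin

open KnuthBendix

/-! ### Right-angled Artin groups

The letter `(x, true)` stands for the generator `x` and `(x, false)` for its inverse. -/

/-- The right-angled Artin group with defining graph `Γ`. -/
abbrev Grp {V : Type*} (Γ : SimpleGraph V) :=
  PresentedGroup {c : FreeGroup V | ∃ x y, Γ.Adj x y ∧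
    c = FreeGroup.of x * FreeGroup.of y * (FreeGroup.of x)⁻¹ * (FreeGroup.of y)⁻¹}

/-- The element of the right-angled Artin group represented by a word. -/
def value {V : Type*} (Γ : SimpleGraph V) (w : List (V × Bool)) : Grp Γ :=
  PresentedGroup.mk _ (FreeGroup.mk w)

/-- The rules of free reduction `x x⁻¹ → 1` and `x⁻¹ x → 1`. -/
def freeRules (V : Type*) : Set (Rule (V × Bool)) :=
  {ρ | ∃ (x : V) (γ : Bool), ρ = ([(x, γ), (x, !γ)], [])}

/-- The commutation rules `x^γ y^ε → y^ε x^γ`, for all edges `x - y` and all signs such that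
`y^ε < x^γ`. -/
def commRules {V : Type*} (Γ : SimpleGraph V) (lt : V × Bool → V × Bool → Prop) :
    Set (Rule (V × Bool)) :=
  {ρ | ∃ (x y : V) (γ ε : Bool), Γ.Adj x y ∧ lt (y, ε) (x, γ) ∧
    ρ = ([(x, γ), (y, ε)], [(y, ε), (x, γ)])}

/-- The ordering of the letters orients the four relations that belong to an edge in the same
way, whatever the signs. -/
def OrientsEdges {V : Type*} (Γ : SimpleGraph V) (lt : V × Bool → V × Bool → Prop) : Prop :=
  ∀ (x y : V) (γ ε γ' ε' : Bool), Γ.Adj x y → lt (y, ε) (x, γ) → lt (y, ε') (x, γ')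

/-- The rule `u x → x u` satisfies the condition on prefixes with respect to `R₀`. -/
def PrefixCondition {α : Type*} (R₀ : Set (Rule α)) (u : List α) (x : α) : Prop :=
  ∃ (t : α) (ts : List α), u = t :: ts ∧ ([t, x], [x, t]) ∈ R₀ ∧
    ∀ s ∈ ts, ([x, s], [s, x]) ∈ R₀

/-- A positive word, that is a word in the generators; the empty word is positive. -/
def Positive {V : Type*} (w : List (V × Bool)) : Prop :=
  ∀ a ∈ w, a.2 = true

/-- The rules of `S` with positive left-hand side. -/
def positivePart {V : Type*} (S : Set (Rule (V × Bool))) : Set (Rule (V × Bool)) :=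
  {ρ | ρ ∈ S ∧ Positive ρ.1}

/-- The condition `C⁺`, for a system with at least one rule with positive left-hand side. -/
def ConditionCPlus {V : Type*} (S : Set (Rule (V × Bool))) : Prop :=
  (positivePart S).Nonempty ∧ ∀ ρ ∈ S, Positive ρ.1 → Positive ρ.2

end RightAngledArtin

/-! A word is normal if no letter can be moved by commutations next to an earlier letter which it
cancels, or in front of a greater commuting letter. Inserting a letter at the place which keeps the
word normal defines a right action of the group on the normal words, in which the element
represented by a normal word takes the empty word to that word (van der Waerden's trick). So normal
words are unique representatives. They are also the irreducible words of the system `T` formed by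
the rules of free reduction and all rules `u x → x u` which satisfy the condition on prefixes and
have `u` normal; therefore `T` is complete.

For `u = u' y` with `u'` non-empty, the overlap of `u' x → x u'` with the commutation rule
`x y → y x` has the critical pair `(x u' y, u' y x)`, the two sides of `u x → x u`, and both are
irreducible modulo the shorter rules of `T`. Conversely, a difference of two normal forms modulo the
rules of length at most `k`, for an overlapped word of length `k + 1`, can only be a rule of `T` of
length `k + 1`. So the completion adds the rules of `T` one length at a time. -/

namespace KnuthBendix

/-! ### Reductions and the shortlex order -/

section Rewriting

variable {α : Type*} {S S' : Set (Rule α)} {a b w z : List α}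

theorem Reduces.mono (h : S ⊆ S') : Reduces S a b → Reduces S' a b := by
  rintro ⟨p, q, ρ, hρ, rfl, rfl⟩
  exact ⟨p, q, ρ, h hρ, rfl, rfl⟩

theorem ReducesStar.mono (h : S ⊆ S') (hab : ReducesStar S a b) : ReducesStar S' a b :=
  Relation.ReflTransGen.mono (fun _ _ => Reduces.mono h) _ _ hab

theorem reduces_of_mem {ρ : Rule α} (h : ρ ∈ S) : Reduces S ρ.1 ρ.2 :=
  ⟨[], [], ρ, h, by simp, by simp⟩

theorem reduces_of_isInfix {ρ : Rule α} (h : ρ ∈ S) (hw : ρ.1 <:+: w) : ∃ z, Reduces S w z := by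
  obtain ⟨p, q, rfl⟩ := hw
  exact ⟨_, p, q, ρ, h, rfl, rfl⟩

theorem irreducible_iff : Irreducible S w ↔ ∀ ρ ∈ S, ¬ ρ.1 <:+: w := by
  refine ⟨fun h ρ hρ hw => h (reduces_of_isInfix hρ hw), ?_⟩
  rintro h ⟨_, p, q, ρ, hρ, rfl, -⟩
  exact h ρ hρ ⟨p, q, rfl⟩

theorem Irreducible.anti (h : S ⊆ S') (hw : Irreducible S' w) : Irreducible S w :=
  fun ⟨z, hz⟩ => hw ⟨z, hz.mono h⟩

theorem Irreducible.eq_of_reducesStar (hw : Irreducible S w) (h : ReducesStar S w z) : z = w :=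
  (Relation.ReflTransGen.cases_head h).elim Eq.symm fun ⟨y, hy, _⟩ => (hw ⟨y, hy⟩).elim

theorem Reduces.append (p q : List α) :
    Reduces S a b → Reduces S (p ++ a ++ q) (p ++ b ++ q) := by
  rintro ⟨p', q', ρ, hρ, rfl, rfl⟩
  exact ⟨p ++ p', q' ++ q, ρ, hρ, by simp, by simp⟩

theorem equivalence_equivalent (S : Set (Rule α)) : Equivalence (Equivalent S) :=
  Relation.EqvGen.is_equivalence _

theorem Equivalent.append (p q : List α) (h : Equivalent S a b) :
    Equivalent S (p ++ a ++ q) (p ++ b ++ q) :=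
  (((equivalence_equivalent S).comap fun w => p ++ w ++ q).eqvGen_iff).1
    (h.mono fun _ _ h => .rel _ _ (h.append p q))

theorem ReducesStar.equivalent (h : ReducesStar S a b) : Equivalent S a b :=
  Relation.EqvGen.reflTransGen_le_eqvGen _ _ _ h

theorem equivalent_of_mem {ρ : Rule α} (h : ρ ∈ S) : Equivalent S ρ.1 ρ.2 :=
  .rel _ _ (reduces_of_mem h)

theorem Equivalent.of_rules (h : ∀ ρ ∈ S, Equivalent S' ρ.1 ρ.2) (hab : Equivalent S a b) :
    Equivalent S' a b := by
  refine (equivalence_equivalent S').eqvGen_iff.1 (hab.mono ?_)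
  rintro _ _ ⟨p, q, ρ, hρ, rfl, rfl⟩
  exact (h ρ hρ).append p q

theorem Terminating.exists_irreducible (h : Terminating S) (w : List α) :
    ∃ z, ReducesStar S w z ∧ Irreducible S z := by
  by_contra! hw
  have step (z : {z // ReducesStar S w z}) :
      ∃ z' : {z // ReducesStar S w z}, Reduces S z.1 z'.1 := by
    obtain ⟨z', hz'⟩ := not_not.1 (hw z.1 z.2)
    exact ⟨⟨z', z.2.tail hz'⟩, hz'⟩
  choose f hf using step
  refine h ⟨fun n => (f^[n] ⟨w, .refl⟩).1, fun n => ?_⟩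
  simpa only [Function.iterate_succ_apply'] using hf _

end Rewriting

section Invariants

variable {α β : Type*} {S : Set (Rule α)} {f : List α → β} {a b : List α}

theorem Equivalent.congr_invariant (hf : ∀ a b, Reduces S a b → f a = f b)
    (h : Equivalent S a b) : f a = f b :=
  (eq_equivalence.comap f).eqvGen_iff.1 (h.mono hf)

theorem Terminating.joinable_of_invariant (hS : Terminating S)
    (hf : ∀ a b, Reduces S a b → f a = f b)
    (hinj : ∀ a b, Irreducible S a → Irreducible S b → f a = f b → a = b) (h : f a = f b) :
    Joinable S a b := by
  obtain ⟨z, haz, hz⟩ := hS.exists_irreducible a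
  obtain ⟨z', hbz', hz'⟩ := hS.exists_irreducible b
  have hzz' : z = z' := hinj z z' hz hz' <| by
    rw [← haz.equivalent.congr_invariant hf, ← hbz'.equivalent.congr_invariant hf, h]
  exact ⟨z, haz, hzz' ▸ hbz'⟩

theorem Terminating.complete_of_invariant (hS : Terminating S)
    (hf : ∀ a b, Reduces S a b → f a = f b)
    (hinj : ∀ a b, Irreducible S a → Irreducible S b → f a = f b → a = b) : Complete S :=
  ⟨hS, fun _ _ _ ha hb => hS.joinable_of_invariant hf hinj <|
    (ha.equivalent.congr_invariant hf).symm.trans (hb.equivalent.congr_invariant hf)⟩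

theorem Terminating.equivalent_iff_of_invariant (hS : Terminating S)
    (hf : ∀ a b, Reduces S a b → f a = f b)
    (hinj : ∀ a b, Irreducible S a → Irreducible S b → f a = f b → a = b) :
    Equivalent S a b ↔ f a = f b := by
  refine ⟨fun h => h.congr_invariant hf, fun h => ?_⟩
  obtain ⟨z, haz, hbz⟩ := hS.joinable_of_invariant hf hinj h
  exact haz.equivalent.trans _ _ _ hbz.equivalent.symm

end Invariants

section Shortlex

variable {α : Type*} {lt : α → α → Prop} {S : Set (Rule α)} {a b : List α}

theorem length_le_of_shortlex (h : List.Shortlex lt a b) : a.length ≤ b.length :=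
  (List.shortlex_def.1 h).elim le_of_lt fun h => h.1.le

theorem lex_append_of_length_eq (q : List α) (hl : a.length = b.length) (h : List.Lex lt a b) :
    List.Lex lt (a ++ q) (b ++ q) := by
  induction h with
  | nil => simp at hl
  | rel h => exact .rel h
  | cons _ ih => exact .cons (ih (Nat.succ.inj hl))

theorem shortlex_append (p q : List α) (h : List.Shortlex lt a b) :
    List.Shortlex lt (p ++ a ++ q) (p ++ b ++ q) := by
  rw [List.append_assoc, List.append_assoc]
  refine List.Shortlex.append_left ?_ p
  rcases List.shortlex_def.1 h with h | ⟨hl, h⟩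
  · exact .of_length_lt (by simpa using h)
  · exact .of_lex (by simpa using hl) (lex_append_of_length_eq q hl h)

theorem Reduces.shortlex (hS : ∀ ρ ∈ S, List.Shortlex lt ρ.2 ρ.1) :
    Reduces S a b → List.Shortlex lt b a := by
  rintro ⟨p, q, ρ, hρ, rfl, rfl⟩
  exact shortlex_append p q (hS ρ hρ)

theorem ReducesStar.length_le (hS : ∀ ρ ∈ S, List.Shortlex lt ρ.2 ρ.1) (h : ReducesStar S a b) :
    b.length ≤ a.length :=
  Relation.ReflTransGen.trans_induction_on (motive := fun {a b} _ => b.length ≤ a.length) h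
    (fun _ => le_rfl) (fun h => length_le_of_shortlex (h.shortlex hS)) fun _ _ h h' => h'.trans h

theorem Reduces.subset (hS : ∀ ρ ∈ S, ρ.2 ⊆ ρ.1) : Reduces S a b → b ⊆ a := by
  rintro ⟨p, q, ρ, hρ, rfl, rfl⟩
  intro x
  simpa only [List.mem_append] using Or.imp_left (Or.imp_right (@hS ρ hρ x))

theorem lex_restrict {s : Set α} (h : List.Lex lt a b) (ha : ∀ x ∈ a, x ∈ s) (hb : ∀ x ∈ b, x ∈ s) :
    List.Lex (fun x y => lt x y ∧ x ∈ s ∧ y ∈ s) a b := by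
  induction h with
  | nil => exact .nil
  | rel h => exact .rel ⟨h, ha _ (by simp), hb _ (by simp)⟩
  | cons _ ih => exact .cons (ih (fun x hx => ha x (by simp [hx])) fun x hx => hb x (by simp [hx]))

/-- The alphabet may be infinite: reductions do not introduce new letters. -/
theorem terminating_of_shortlex [IsStrictOrder α lt] (hS : ∀ ρ ∈ S, List.Shortlex lt ρ.2 ρ.1)
    (hsub : ∀ ρ ∈ S, ρ.2 ⊆ ρ.1) : Terminating S := by
  rintro ⟨f, hf⟩
  let s : Set α := {x | x ∈ f 0}
  have hfs (n : ℕ) : ∀ x ∈ f n, x ∈ s := by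
    induction n with
    | zero => exact fun _ => id
    | succ n ih => exact fun x hx => ih x ((hf n).subset hsub hx)
  have hwf : WellFounded (List.Shortlex fun x y => lt x y ∧ x ∈ s ∧ y ∈ s) :=
    List.Shortlex.wf (Set.wellFoundedOn_iff.1 (f 0).finite_toSet.wellFoundedOn)
  refine (wellFounded_iff_isEmpty_descending_chain.1 hwf).false ⟨f, fun n => ?_⟩
  rcases List.shortlex_def.1 ((hf n).shortlex hS) with h | ⟨hl, h⟩
  · exact .of_length_lt h
  · exact .of_lex hl (lex_restrict h (hfs _) (hfs _))

end Shortlex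

/-! ### Systems generated length by length -/

section Overlaps

variable {α : Type*} {lt : α → α → Prop} {nf : Set (Rule α) → List α → List α}
  {S S' : Set (Rule α)} {o : Overlap α}

theorem Overlap.length_eq_left_add (o : Overlap α) : o.length = o.left.1.length + o.w.length :=
  List.length_append

theorem Overlap.length_eq_add_right (o : Overlap α) : o.length = o.u.length + o.right.1.length := by
  simp [Overlap.length, Overlap.right]

namespace Overlap.IsIn

theorem mono (hS : S ⊆ S') (h : o.IsIn S) : o.IsIn S' :=
  ⟨h.1, h.2.1, h.2.2.1, hS h.2.2.2.1, hS h.2.2.2.2⟩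

theorem left_mem (h : o.IsIn S) : o.left ∈ S := h.2.2.2.1

theorem right_mem (h : o.IsIn S) : o.right ∈ S := h.2.2.2.2

theorem left_length_lt (h : o.IsIn S) : o.left.1.length < o.length := by
  rw [o.length_eq_left_add]
  exact Nat.lt_add_of_pos_right (List.length_pos_iff.2 h.2.2.1)

theorem right_length_lt (h : o.IsIn S) : o.right.1.length < o.length := by
  rw [o.length_eq_add_right]
  exact Nat.lt_add_of_pos_left (List.length_pos_iff.2 h.1)

theorem reduces_crit₁ (h : o.IsIn S) : Reduces S (o.u ++ o.v ++ o.w) o.crit₁ :=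
  ⟨[], o.w, o.left, h.left_mem, rfl, rfl⟩

theorem reduces_crit₂ (h : o.IsIn S) : Reduces S (o.u ++ o.v ++ o.w) o.crit₂ :=
  ⟨o.u, [], o.right, h.right_mem, by simp [Overlap.right], by simp [Overlap.right, Overlap.crit₂]⟩

theorem equivalent_crit (h : o.IsIn S) : Equivalent S o.crit₁ o.crit₂ :=
  .trans _ _ _ (.symm _ _ (.rel _ _ h.reduces_crit₁)) (.rel _ _ h.reduces_crit₂)

end Overlap.IsIn

theorem Overlap.resolves_or_exists_produces [Std.Trichotomous lt]
    (hnf : ∀ w, ReducesStar S w (nf S w)) (o : Overlap α) :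
    o.Resolves S ∨ ∃ ρ, Produces lt nf S o ρ := by
  rcases trichotomous_of (List.Shortlex lt) (nf S o.crit₁) (nf S o.crit₂) with h | h | h
  · exact .inr ⟨(_, _), h, .inr rfl⟩
  · exact .inl ⟨_, hnf _, h ▸ hnf _⟩
  · exact .inr ⟨(_, _), h, .inl rfl⟩

theorem exists_mem_next_of_mem_treated {S₀ : Set (Rule α)} {n : ℕ}
    (h : o ∈ (run lt nf S₀ n).treated) : ∃ m, o ∈ (run lt nf S₀ m).next := by
  induction n with
  | zero => exact h.elim
  | succ n ih => exact h.elim ih fun h => ⟨n, h⟩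

end Overlaps

section Truncation

variable {α : Type*} {T : Set (Rule α)} {k : ℕ} {w : List α} {o : Overlap α}

/-- The rules of `T` with left-hand side of length at most `k`. These are the stages through which
the completion reaches a system that is generated length by length. -/
def truncation (T : Set (Rule α)) (k : ℕ) : Set (Rule α) := {ρ | ρ ∈ T ∧ ρ.1.length ≤ k}

theorem truncation_subset : truncation T k ⊆ T := fun _ h => h.1

theorem truncation_succ :
    truncation T (k + 1) = truncation T k ∪ {ρ | ρ ∈ T ∧ ρ.1.length = k + 1} := by
  ext ρ
  simp only [truncation, Set.mem_union, Set.mem_ofPred_eq, ← and_or_left, Nat.le_succ_iff]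

theorem Overlap.IsIn.truncation (h : o.IsIn T) (hk : o.length ≤ k + 1) :
    o.IsIn (truncation T k) :=
  ⟨h.1, h.2.1, h.2.2.1, ⟨h.left_mem, Nat.le_of_lt_succ (h.left_length_lt.trans_le hk)⟩,
    ⟨h.right_mem, Nat.le_of_lt_succ (h.right_length_lt.trans_le hk)⟩⟩

theorem exists_isInfix_of_irreducible_truncation (hw : Irreducible (truncation T k) w)
    (hT : ¬ Irreducible T w) : ∃ ρ ∈ T, k < ρ.1.length ∧ ρ.1 <:+: w := by
  rw [irreducible_iff] at hw hT
  push Not at hT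
  obtain ⟨ρ, hρ, hρw⟩ := hT
  exact ⟨ρ, hρ, not_le.1 fun hk => hw ρ ⟨hρ, hk⟩ hρw, hρw⟩

theorem irreducible_or_exists_mem_of_irreducible_truncation (hw : Irreducible (truncation T k) w)
    (hk : w.length ≤ k + 1) : Irreducible T w ∨ w.length = k + 1 ∧ ∃ r, (w, r) ∈ T := by
  refine or_iff_not_imp_left.2 fun hT => ?_
  obtain ⟨⟨l, r⟩, hρ, hkl, hlw⟩ := exists_isInfix_of_irreducible_truncation hw hT
  obtain rfl : l = w := hlw.eq_of_length_le (hk.trans hkl)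
  exact ⟨hk.antisymm hkl, r, hρ⟩

end Truncation

/-- The system `T` can be obtained by completion, one length at a time: it is a reduced system with
unique irreducible words in which each rule `l → r` with `3 ≤ |l|` comes from an overlap of total
length `|l|` with critical pair `(r, l)`, the rule at left being one letter shorter. -/
structure LengthwiseGenerated {α : Type*} (lt : α → α → Prop) (T : Set (Rule α)) : Prop where
  shortlex : ∀ ρ ∈ T, List.Shortlex lt ρ.2 ρ.1
  two_le_length : ∀ ρ ∈ T, 2 ≤ ρ.1.length
  eq_of_equivalent : ∀ a b, Irreducible T a → Irreducible T b → Equivalent T a b → a = b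
  irreducible_rhs : ∀ ρ ∈ T, Irreducible T ρ.2
  irreducible_lhs : ∀ ρ ∈ T, ∀ k < ρ.1.length, Irreducible (truncation T k) ρ.1
  lhs_eq : ∀ l l' r, (l, r) ∈ T → (l', r) ∈ T → 3 ≤ l.length → 3 ≤ l'.length → l = l'
  exists_overlap : ∀ ρ ∈ T, 3 ≤ ρ.1.length → ∃ o : Overlap α, o.IsIn T ∧
    o.length = ρ.1.length ∧ o.left.1.length + 1 = ρ.1.length ∧ o.crit₁ = ρ.2 ∧ o.crit₂ = ρ.1

namespace LengthwiseGenerated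

variable {α : Type*} {lt : α → α → Prop} {T : Set (Rule α)}
  {nf : Set (Rule α) → List α → List α} {k : ℕ} {o : Overlap α} {ρ : Rule α} {w : List α}

theorem exists_mem_length_eq (hT : LengthwiseGenerated lt T) (hk : 2 ≤ k) (hρ : ρ ∈ T)
    (hl : k ≤ ρ.1.length) : ∃ ρ' ∈ T, ρ'.1.length = k := by
  induction hn : ρ.1.length - k generalizing ρ with
  | zero => exact ⟨ρ, hρ, by omega⟩
  | succ n ih =>
    obtain ⟨o, ho, -, hleft, -⟩ := hT.exists_overlap ρ hρ (by omega)
    exact ih ho.left_mem (by omega) (by omega)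

theorem reducesStar_nf (hT : LengthwiseGenerated lt T) (hnf : IsNormalizer lt nf) (k : ℕ)
    (w : List α) : ReducesStar (truncation T k) w (nf (truncation T k) w) :=
  (hnf _ (fun ρ hρ => hT.shortlex ρ hρ.1) w).1

theorem irreducible_nf (hT : LengthwiseGenerated lt T) (hnf : IsNormalizer lt nf) (k : ℕ)
    (w : List α) : Irreducible (truncation T k) (nf (truncation T k) w) :=
  (hnf _ (fun ρ hρ => hT.shortlex ρ hρ.1) w).2

theorem nf_eq_self (hT : LengthwiseGenerated lt T) (hnf : IsNormalizer lt nf)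
    (hw : Irreducible (truncation T k) w) : nf (truncation T k) w = w :=
  hw.eq_of_reducesStar (hT.reducesStar_nf hnf k w)

theorem equivalent_nf_crit (hT : LengthwiseGenerated lt T) (hnf : IsNormalizer lt nf)
    (ho : o.IsIn (truncation T k)) :
    Equivalent T (nf (truncation T k) o.crit₁) (nf (truncation T k) o.crit₂) := by
  have h (w : List α) : Equivalent T w (nf (truncation T k) w) :=
    ((hT.reducesStar_nf hnf k w).mono truncation_subset).equivalent
  exact .trans _ _ _ (.symm _ _ (h _)) <|
    .trans _ _ _ (ho.mono truncation_subset).equivalent_crit (h _)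

theorem length_nf_crit_le (hT : LengthwiseGenerated lt T) (hnf : IsNormalizer lt nf)
    (ho : o.IsIn T) : (nf (truncation T k) o.crit₁).length ≤ o.length ∧
      (nf (truncation T k) o.crit₂).length ≤ o.length := by
  have h (w : List α) (hw : Reduces T (o.u ++ o.v ++ o.w) w) :
      (nf (truncation T k) w).length ≤ o.length :=
    ReducesStar.length_le hT.shortlex
      (.head hw ((hT.reducesStar_nf hnf k w).mono truncation_subset))
  exact ⟨h _ ho.reduces_crit₁, h _ ho.reduces_crit₂⟩

theorem mem_of_shortlex [Std.Asymm lt] (hT : LengthwiseGenerated lt T) {p q : List α} (hk : 2 ≤ k)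
    (hp : Irreducible (truncation T k) p) (hq : Irreducible (truncation T k) q)
    (hpk : p.length ≤ k + 1) (hqk : q.length ≤ k + 1) (hpq : Equivalent T p q)
    (hlt : List.Shortlex lt q p) : (p, q) ∈ T ∧ p.length = k + 1 := by
  have hne : p ≠ q := by
    rintro rfl
    exact asymm_of (List.Shortlex lt) hlt hlt
  rcases irreducible_or_exists_mem_of_irreducible_truncation hp hpk with hp' | ⟨hpl, r, hr⟩ <;>
  rcases irreducible_or_exists_mem_of_irreducible_truncation hq hqk with hq' | ⟨hql, r', hr'⟩
  · exact (hne (hT.eq_of_equivalent p q hp' hq' hpq)).elim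
  · obtain rfl : p = r' := hT.eq_of_equivalent _ _ hp' (hT.irreducible_rhs _ hr')
      (hpq.trans _ _ _ (equivalent_of_mem hr'))
    exact (asymm_of (List.Shortlex lt) hlt (hT.shortlex _ hr')).elim
  · obtain rfl : r = q := hT.eq_of_equivalent _ _ (hT.irreducible_rhs _ hr) hq'
      ((equivalent_of_mem hr).symm.trans _ _ _ hpq)
    exact ⟨hr, hpl⟩
  · obtain rfl : r = r' := hT.eq_of_equivalent _ _ (hT.irreducible_rhs _ hr)
      (hT.irreducible_rhs _ hr')
      ((equivalent_of_mem hr).symm.trans _ _ _ (hpq.trans _ _ _ (equivalent_of_mem hr')))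
    exact (hne (hT.lhs_eq p q r hr hr' (by omega) (by omega))).elim

theorem mem_of_produces [Std.Asymm lt] (hT : LengthwiseGenerated lt T) (hnf : IsNormalizer lt nf)
    (hk : 2 ≤ k) (ho : o.IsIn (truncation T k)) (hok : o.length ≤ k + 1)
    (hρ : Produces lt nf (truncation T k) o ρ) : ρ ∈ T ∧ ρ.1.length = k + 1 := by
  obtain ⟨hl₁, hl₂⟩ := hT.length_nf_crit_le (k := k) hnf (ho.mono truncation_subset)
  have heq := hT.equivalent_nf_crit hnf ho
  obtain ⟨hlt, rfl | rfl⟩ := hρ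
  · exact hT.mem_of_shortlex hk (hT.irreducible_nf hnf k _) (hT.irreducible_nf hnf k _)
      (hl₁.trans hok) (hl₂.trans hok) heq hlt
  · exact hT.mem_of_shortlex hk (hT.irreducible_nf hnf k _) (hT.irreducible_nf hnf k _)
      (hl₂.trans hok) (hl₁.trans hok) heq.symm hlt

theorem exists_mem_length_gt_of_produces [Std.Asymm lt] (hT : LengthwiseGenerated lt T)
    (hnf : IsNormalizer lt nf) (ho : o.IsIn (truncation T k))
    (hρ : Produces lt nf (truncation T k) o ρ) : ∃ ρ' ∈ T, k < ρ'.1.length := by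
  by_contra! h
  have htrunc : truncation T k = T := truncation_subset.antisymm fun ρ' hρ' => ⟨hρ', h ρ' hρ'⟩
  have hirr (w : List α) : Irreducible T (nf (truncation T k) w) := by
    simpa only [htrunc] using hT.irreducible_nf hnf k w
  have heq := hT.eq_of_equivalent _ _ (hirr o.crit₁) (hirr o.crit₂) (hT.equivalent_nf_crit hnf ho)
  obtain ⟨hlt, rfl | rfl⟩ := hρ <;> rw [heq] at hlt <;>
    exact asymm_of (List.Shortlex lt) hlt hlt

theorem exists_produces (hT : LengthwiseGenerated lt T) (hnf : IsNormalizer lt nf) (hk : 2 ≤ k)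
    (hρ : ρ ∈ T) (hl : ρ.1.length = k + 1) : ∃ o : Overlap α, o.IsIn (truncation T k) ∧
      o.length = k + 1 ∧ o.left.1.length = k ∧ Produces lt nf (truncation T k) o ρ := by
  obtain ⟨o, ho, hol, hleft, h₁, h₂⟩ := hT.exists_overlap ρ hρ (by omega)
  refine ⟨o, ho.truncation (by omega), by omega, by omega, hT.shortlex ρ hρ, .inr ?_⟩
  rw [h₁, h₂, hT.nf_eq_self hnf (hT.irreducible_lhs ρ hρ k (by omega)),
    hT.nf_eq_self hnf ((hT.irreducible_rhs ρ hρ).anti truncation_subset)]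

end LengthwiseGenerated

/-- The properties of a state of the completion of `truncation T 2` that a step preserves; the
index `k` grows by one with each step. -/
structure StateInvariant {α : Type*} (T : Set (Rule α)) (k : ℕ) (s : State α) : Prop where
  two_le : 2 ≤ k
  rules_eq : s.rules = truncation T k
  treated_of_length_le : ∀ o : Overlap α, o.IsIn s.rules → o.length ≤ k → o ∈ s.treated
  left_of_treated : ∀ o ∈ s.treated, o.left.1.length < k

namespace StateInvariant

variable {α : Type*} {lt : α → α → Prop} {T : Set (Rule α)}
  {nf : Set (Rule α) → List α → List α} {k : ℕ} {s : State α} {o : Overlap α} {ρ : Rule α}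

theorem length_gt_of_pending (h : StateInvariant T k s) (ho : o ∈ s.pending) : k < o.length :=
  not_le.1 fun hl => ho.2 (h.treated_of_length_le o ho.1 hl)

theorem isIn_truncation (h : StateInvariant T k s) (ho : o ∈ s.next) :
    o.IsIn (truncation T k) :=
  h.rules_eq ▸ ho.1.1

theorem exists_mem_next_produces (hT : LengthwiseGenerated lt T) (hnf : IsNormalizer lt nf)
    (h : StateInvariant T k s) (hρ : ρ ∈ T) (hl : ρ.1.length = k + 1) :
    ∃ o ∈ s.next, o.length = k + 1 ∧ Produces lt nf s.rules o ρ := by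
  obtain ⟨o, ho, hol, hleft, hp⟩ := hT.exists_produces hnf h.two_le hρ hl
  rw [← h.rules_eq] at ho hp
  refine ⟨o, ⟨⟨ho, fun ht => (h.left_of_treated o ht).ne hleft⟩, fun o' ho' => ?_⟩, hol, hp⟩
  exact hol.trans_le (h.length_gt_of_pending ho')

theorem length_of_produces [Std.Asymm lt] (hT : LengthwiseGenerated lt T)
    (hnf : IsNormalizer lt nf) (h : StateInvariant T k s) (ho : o ∈ s.next)
    (hρ : Produces lt nf s.rules o ρ) : o.length = k + 1 := by
  obtain ⟨ρ₁, hρ₁, hl₁⟩ :=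
    hT.exists_mem_length_gt_of_produces hnf (h.isIn_truncation ho) (h.rules_eq ▸ hρ)
  obtain ⟨ρ₂, hρ₂, hl₂⟩ := hT.exists_mem_length_eq (Nat.le_succ_of_le h.two_le) hρ₁ hl₁
  obtain ⟨o', ho', hl', -⟩ := h.exists_mem_next_produces hT hnf hρ₂ hl₂
  exact le_antisymm (hl' ▸ ho.2 o' ho'.1) (h.length_gt_of_pending ho.1)

theorem mem_of_produces [Std.Asymm lt] (hT : LengthwiseGenerated lt T)
    (hnf : IsNormalizer lt nf) (h : StateInvariant T k s) (ho : o ∈ s.next)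
    (hρ : Produces lt nf s.rules o ρ) : ρ ∈ T ∧ ρ.1.length = k + 1 :=
  hT.mem_of_produces hnf h.two_le (h.isIn_truncation ho) (h.length_of_produces hT hnf ho hρ).le
    (h.rules_eq ▸ hρ)

theorem newRules_eq [Std.Asymm lt] (hT : LengthwiseGenerated lt T) (hnf : IsNormalizer lt nf)
    (h : StateInvariant T k s) :
    s.newRules lt nf = {ρ | ρ ∈ T ∧ ρ.1.length = k + 1} := by
  ext ρ
  constructor
  · rintro ⟨o, ho, hρ⟩
    exact h.mem_of_produces hT hnf ho hρ
  · rintro ⟨hρ, hl⟩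
    obtain ⟨o, ho, -, hp⟩ := h.exists_mem_next_produces hT hnf hρ hl
    exact ⟨o, ho, hp⟩

theorem step [Std.Asymm lt] (hT : LengthwiseGenerated lt T) (hnf : IsNormalizer lt nf)
    (h : StateInvariant T k s) : StateInvariant T (k + 1) (s.step lt nf) := by
  have hrules : (s.step lt nf).rules = truncation T (k + 1) := by
    rw [State.step, h.newRules_eq hT hnf, h.rules_eq, truncation_succ]
  refine ⟨h.two_le.trans k.le_succ, hrules, fun o ho hl => ?_, ?_⟩
  · have hos : o.IsIn s.rules :=
      h.rules_eq ▸ ((hrules ▸ ho).mono truncation_subset).truncation hl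
    refine or_iff_not_imp_left.2 fun ht => ⟨⟨hos, ht⟩, fun o' ho' => ?_⟩
    exact hl.trans (h.length_gt_of_pending ho')
  · rintro o (ho | ho)
    · exact (h.left_of_treated o ho).trans k.lt_succ_self
    · exact Nat.lt_succ_of_le (h.isIn_truncation ho).left_mem.2

end StateInvariant

namespace LengthwiseGenerated

variable {α : Type*} {lt : α → α → Prop} [Std.Asymm lt] {T : Set (Rule α)}
  {nf : Set (Rule α) → List α → List α} {o : Overlap α}

theorem stateInvariant_run (hT : LengthwiseGenerated lt T) (hnf : IsNormalizer lt nf) (n : ℕ) :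
    StateInvariant T (n + 2) (run lt nf (truncation T 2) n) := by
  induction n with
  | zero =>
    refine ⟨le_rfl, rfl, fun o ho hl => ?_, fun _ h => h.elim⟩
    exact ((hT.two_le_length _ ho.left_mem.1).not_gt (ho.left_length_lt.trans_le hl)).elim
  | succ n ih => exact ih.step hT hnf

theorem run_rules (hT : LengthwiseGenerated lt T) (hnf : IsNormalizer lt nf) (n : ℕ) :
    (run lt nf (truncation T 2) n).rules = truncation T (n + 2) :=
  (hT.stateInvariant_run hnf n).rules_eq

theorem completion_eq (hT : LengthwiseGenerated lt T) (hnf : IsNormalizer lt nf) :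
    completion lt nf (truncation T 2) = T := by
  simp only [completion, hT.run_rules hnf]
  exact (Set.iUnion_subset fun _ => truncation_subset).antisymm fun ρ hρ =>
    Set.mem_iUnion.2 ⟨ρ.1.length, hρ, Nat.le_add_right _ 2⟩

theorem exists_mem_next (hT : LengthwiseGenerated lt T) (hnf : IsNormalizer lt nf)
    (ho : o.IsIn T) : ∃ n, o ∈ (run lt nf (truncation T 2) n).next := by
  refine exists_mem_next_of_mem_treated (n := o.length) <|
    (hT.stateInvariant_run hnf o.length).treated_of_length_le o ?_ (Nat.le_add_right _ 2)
  rw [hT.run_rules hnf]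
  exact ho.truncation (by omega)

end LengthwiseGenerated

end KnuthBendix

namespace RightAngledArtin

open KnuthBendix

/-! ### Normal words -/

section Letters

variable {V : Type*} {Γ : SimpleGraph V} {a b c : V × Bool} {v w : List (V × Bool)}

/-- The inverse of a letter. -/
def letterInv (a : V × Bool) : V × Bool := (a.1, !a.2)

@[simp]
theorem letterInv_letterInv (a : V × Bool) : letterInv (letterInv a) = a := by
  simp [letterInv]

theorem ne_of_adj (h : Γ.Adj a.1 b.1) : a ≠ b := fun hab => h.ne (congrArg Prod.fst hab)

theorem ne_letterInv_of_adj (h : Γ.Adj a.1 b.1) : a ≠ letterInv b :=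
  fun hab => h.ne (show a.1 = (letterInv b).1 from congrArg Prod.fst hab)

theorem lt_or_lt_of_adj {lt : V × Bool → V × Bool → Prop} [Std.Trichotomous lt]
    (h : Γ.Adj a.1 b.1) : lt a b ∨ lt b a :=
  (trichotomous_of lt a b).imp_right fun h' => h'.resolve_left (ne_of_adj h)

variable (Γ) in
/-- All letters of the word `w` are adjacent to the letter `a`. -/
def AllAdj (a : V × Bool) (w : List (V × Bool)) : Prop := ∀ c ∈ w, Γ.Adj c.1 a.1

theorem allAdj_nil (a : V × Bool) : AllAdj Γ a [] := fun _ h => absurd h List.not_mem_nil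

theorem allAdj_cons : AllAdj Γ a (c :: w) ↔ Γ.Adj c.1 a.1 ∧ AllAdj Γ a w :=
  List.forall_mem_cons

theorem allAdj_singleton : AllAdj Γ a [c] ↔ Γ.Adj c.1 a.1 := List.forall_mem_singleton

theorem AllAdj.notMem (h : AllAdj Γ a w) : a ∉ w := fun ha => Γ.irrefl (h a ha)

variable (Γ) in
/-- The letter `a` can be moved to the front of the word by commutations. -/
def Front (a : V × Bool) : List (V × Bool) → Prop
  | [] => False
  | c :: w => a = c ∨ (Γ.Adj a.1 c.1 ∧ Front a w)

theorem Front.mem (h : Front Γ a w) : a ∈ w := by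
  induction w with
  | nil => exact h.elim
  | cons c w ih => exact List.mem_cons.2 (h.imp_right fun h => ih h.2)

theorem front_append : Front Γ a (w ++ v) ↔ Front Γ a w ∨ AllAdj Γ a w ∧ Front Γ a v := by
  induction w with
  | nil => simp [Front, allAdj_nil]
  | cons c w ih =>
    rw [List.cons_append, Front, Front, ih, allAdj_cons, Γ.adj_comm c.1]
    tauto

theorem front_cons_self (a : V × Bool) (w : List (V × Bool)) : Front Γ a (a :: w) := .inl rfl

theorem Front.exists_append (h : Front Γ a w) : ∃ u v, w = u ++ a :: v ∧ AllAdj Γ a u := by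
  induction w with
  | nil => exact h.elim
  | cons c w ih =>
    rcases h with rfl | ⟨hac, h⟩
    · exact ⟨[], w, rfl, allAdj_nil _⟩
    · obtain ⟨u, v, rfl, hu⟩ := ih h
      exact ⟨c :: u, v, rfl, allAdj_cons.2 ⟨hac.symm, hu⟩⟩

end Letters

section NormalWords

variable {V : Type*} {Γ : SimpleGraph V} {lt : V × Bool → V × Bool → Prop} {a x : V × Bool}
  {p q w : List (V × Bool)}

variable (Γ lt) in
/-- A word is normal if no letter can be moved by commutations next to an earlier letter which it
cancels, or in front of a greater commuting letter. -/
def NormalWord : List (V × Bool) → Prop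
  | [] => True
  | c :: w => (∀ a, Front Γ a w → a ≠ letterInv c ∧ (Γ.Adj a.1 c.1 → lt c a)) ∧ NormalWord w

theorem normalWord_singleton (a : V × Bool) : NormalWord Γ lt [a] := ⟨fun _ h => h.elim, trivial⟩

theorem NormalWord.of_append_right (h : NormalWord Γ lt (p ++ q)) : NormalWord Γ lt q := by
  induction p with
  | nil => exact h
  | cons _ _ ih => exact ih h.2

theorem NormalWord.of_append_left (h : NormalWord Γ lt (p ++ q)) : NormalWord Γ lt p := by
  induction p with
  | nil => trivial
  | cons _ _ ih => exact ⟨fun a ha => h.1 a (front_append.2 (.inl ha)), ih h.2⟩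

theorem NormalWord.append_singleton (h : NormalWord Γ lt w) (hadj : AllAdj Γ x w)
    (hx : ∀ c ∈ w, lt c x) : NormalWord Γ lt (w ++ [x]) := by
  induction w with
  | nil => exact normalWord_singleton x
  | cons c w ih =>
    rw [allAdj_cons] at hadj
    refine ⟨fun a ha => ?_, ih h.2 hadj.2 fun d hd => hx d (List.mem_cons_of_mem c hd)⟩
    rcases front_append.1 ha with ha | ⟨-, rfl | ha⟩
    · exact h.1 a ha
    · exact ⟨ne_letterInv_of_adj hadj.1.symm, fun _ => hx c List.mem_cons_self⟩
    · exact ha.2.elim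

theorem NormalWord.not_front_letterInv (h : NormalWord Γ lt (a :: w)) :
    ¬ Front Γ (letterInv a) w :=
  fun hf => (h.1 _ hf).1 rfl

theorem NormalWord.lt_of_front (h : NormalWord Γ lt (x :: w)) (ha : Front Γ a w)
    (hadj : Γ.Adj a.1 x.1) : lt x a :=
  (h.1 a ha).2 hadj

end NormalWords

section InsertLetter

variable {V : Type*} {Γ : SimpleGraph V} {lt : V × Bool → V × Bool → Prop} {a b c : V × Bool}
  {w : List (V × Bool)}

open Classical in
variable (Γ lt) in
/-- Right multiplication of a normal word by a letter. -/
noncomputable def insertLetter (a : V × Bool) : List (V × Bool) → List (V × Bool)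
  | [] => [a]
  | c :: w =>
    if AllAdj Γ a w ∧ c = letterInv a then w
    else if AllAdj Γ a (c :: w) ∧ lt a c then a :: c :: w
    else c :: insertLetter a w

theorem insertLetter_of_cancel (h : AllAdj Γ a w) (hc : c = letterInv a) :
    insertLetter Γ lt a (c :: w) = w := by
  rw [insertLetter, if_pos ⟨h, hc⟩]

theorem insertLetter_of_lt (h : AllAdj Γ a (c :: w)) (hc : lt a c) :
    insertLetter Γ lt a (c :: w) = a :: c :: w := by
  rw [insertLetter, if_neg, if_pos ⟨h, hc⟩]
  exact fun h' => ne_letterInv_of_adj (h c List.mem_cons_self) h'.2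

theorem insertLetter_of_not (h₁ : ¬ (AllAdj Γ a w ∧ c = letterInv a))
    (h₂ : ¬ (AllAdj Γ a (c :: w) ∧ lt a c)) :
    insertLetter Γ lt a (c :: w) = c :: insertLetter Γ lt a w := by
  rw [insertLetter, if_neg h₁, if_neg h₂]

theorem insertLetter_cases (Γ : SimpleGraph V) (lt : V × Bool → V × Bool → Prop) (a c : V × Bool)
    (w : List (V × Bool)) :
    (AllAdj Γ a w ∧ c = letterInv a) ∨ (AllAdj Γ a (c :: w) ∧ lt a c) ∨
      (¬ (AllAdj Γ a w ∧ c = letterInv a) ∧ ¬ (AllAdj Γ a (c :: w) ∧ lt a c)) := by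
  tauto

theorem insertLetter_eq_cons (h : AllAdj Γ a w) (hlt : ∀ b, Front Γ b w → lt a b) :
    insertLetter Γ lt a w = a :: w := by
  cases w with
  | nil => rfl
  | cons c w => exact insertLetter_of_lt h (hlt c (front_cons_self c w))

theorem insertLetter_cons_of_lt [Std.Asymm lt] (hab : Γ.Adj a.1 b.1) (h : lt a b) :
    insertLetter Γ lt b (a :: w) = a :: insertLetter Γ lt b w :=
  insertLetter_of_not (fun h' => ne_letterInv_of_adj hab h'.2) fun h' => asymm_of lt h h'.2

theorem front_of_front_insertLetter (h : Front Γ b (insertLetter Γ lt a w)) :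
    Front Γ b w ∨ (b = a ∧ AllAdj Γ a w) := by
  induction w with
  | nil => exact .inr ⟨h.resolve_right And.right, allAdj_nil _⟩
  | cons c w ih =>
    rcases insertLetter_cases Γ lt a c w with ⟨h₁, rfl⟩ | ⟨h₁, h₂⟩ | ⟨h₁, h₂⟩
    · rw [insertLetter_of_cancel h₁ rfl] at h
      exact .inl (.inr ⟨h₁ _ h.mem, h⟩)
    · rw [insertLetter_of_lt h₁ h₂] at h
      exact h.elim (fun h => .inr ⟨h, h₁⟩) fun h => .inl h.2
    · rw [insertLetter_of_not h₁ h₂] at h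
      rcases h with h | ⟨h, h'⟩
      · exact .inl (.inl h)
      · refine (ih h').imp (fun h' => .inr ⟨h, h'⟩) ?_
        rintro ⟨rfl, h'⟩
        exact ⟨rfl, allAdj_cons.2 ⟨h.symm, h'⟩⟩

theorem allAdj_insertLetter_iff (hab : Γ.Adj a.1 b.1) :
    AllAdj Γ b (insertLetter Γ lt a w) ↔ AllAdj Γ b w := by
  induction w with
  | nil => exact iff_of_true (allAdj_singleton.2 hab) (allAdj_nil b)
  | cons c w ih =>
    rcases insertLetter_cases Γ lt a c w with ⟨h₁, rfl⟩ | ⟨h₁, h₂⟩ | ⟨h₁, h₂⟩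
    · rw [insertLetter_of_cancel h₁ rfl, allAdj_cons]
      exact (and_iff_right hab).symm
    · rw [insertLetter_of_lt h₁ h₂, allAdj_cons (c := a)]
      exact and_iff_right hab
    · rw [insertLetter_of_not h₁ h₂, allAdj_cons, allAdj_cons, ih]

theorem front_letterInv_of_allAdj_insertLetter (h : AllAdj Γ a (insertLetter Γ lt a w)) :
    Front Γ (letterInv a) w := by
  induction w with
  | nil => exact (h.notMem List.mem_cons_self).elim
  | cons c w ih =>
    rcases insertLetter_cases Γ lt a c w with ⟨-, rfl⟩ | ⟨h₁, h₂⟩ | ⟨h₁, h₂⟩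
    · exact .inl rfl
    · rw [insertLetter_of_lt h₁ h₂] at h
      exact (h.notMem List.mem_cons_self).elim
    · rw [insertLetter_of_not h₁ h₂, allAdj_cons] at h
      exact .inr ⟨h.1.symm, ih h.2⟩

theorem NormalWord.insertLetter_eq_append [Std.Asymm lt] (h : NormalWord Γ lt (w ++ [a])) :
    insertLetter Γ lt a w = w ++ [a] := by
  induction w with
  | nil => rfl
  | cons c w ih =>
    have ha (hw : AllAdj Γ a w) : Front Γ a (w ++ [a]) :=
      front_append.2 (.inr ⟨hw, front_cons_self a []⟩)
    rw [insertLetter_of_not, ih h.2, List.cons_append]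
    · rintro ⟨hw, rfl⟩
      exact (h.1 a (ha hw)).1 (letterInv_letterInv a).symm
    · rintro ⟨hw, hac⟩
      rw [allAdj_cons] at hw
      exact asymm_of lt hac (h.lt_of_front (ha hw.2) hw.1.symm)

theorem NormalWord.normalWord_insertLetter [Std.Trichotomous lt] [IsTrans (V × Bool) lt]
    (h : NormalWord Γ lt w) : NormalWord Γ lt (insertLetter Γ lt a w) := by
  induction w with
  | nil => exact normalWord_singleton a
  | cons c w ih =>
    rcases insertLetter_cases Γ lt a c w with ⟨h₁, rfl⟩ | ⟨h₁, h₂⟩ | ⟨h₁, h₂⟩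
    · rw [insertLetter_of_cancel h₁ rfl]
      exact h.2
    · rw [insertLetter_of_lt h₁ h₂]
      refine ⟨fun b hb => ⟨ne_letterInv_of_adj (h₁ b hb.mem), fun _ => ?_⟩, h⟩
      rcases hb with rfl | ⟨hbc, hb⟩
      · exact h₂
      · exact trans_of lt h₂ (h.lt_of_front hb hbc)
    · rw [insertLetter_of_not h₁ h₂]
      refine ⟨fun b hb => ?_, ih h.2⟩
      rcases front_of_front_insertLetter hb with hb | ⟨rfl, hb⟩
      · exact h.1 b hb
      · refine ⟨fun hbc => h₁ ⟨hb, by rw [hbc, letterInv_letterInv]⟩, fun hbc => ?_⟩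
        exact (lt_or_lt_of_adj hbc).resolve_left fun hlt =>
          h₂ ⟨allAdj_cons.2 ⟨hbc.symm, hb⟩, hlt⟩

theorem NormalWord.insertLetter_letterInv_insertLetter [Std.Asymm lt] (a : V × Bool)
    (h : NormalWord Γ lt w) :
    insertLetter Γ lt (letterInv a) (insertLetter Γ lt a w) = w := by
  induction w with
  | nil => exact insertLetter_of_cancel (allAdj_nil _) (letterInv_letterInv a).symm
  | cons c w ih =>
    rcases insertLetter_cases Γ lt a c w with ⟨h₁, rfl⟩ | ⟨h₁, h₂⟩ | ⟨h₁, h₂⟩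
    · rw [insertLetter_of_cancel h₁ rfl]
      exact insertLetter_eq_cons h₁ fun b hb => h.lt_of_front hb (h₁ b hb.mem)
    · rw [insertLetter_of_lt h₁ h₂]
      exact insertLetter_of_cancel h₁ (letterInv_letterInv a).symm
    · rw [insertLetter_of_not h₁ h₂, insertLetter_of_not, ih h.2]
      · rintro ⟨hw, rfl⟩
        rw [letterInv_letterInv] at h
        exact h.not_front_letterInv (front_letterInv_of_allAdj_insertLetter hw)
      · rintro ⟨hw, hac⟩
        rw [allAdj_cons] at hw
        exact asymm_of lt hac
          (h.lt_of_front (front_letterInv_of_allAdj_insertLetter hw.2) hw.1.symm)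

theorem NormalWord.insertLetter_comm_of_cancel [IsStrictOrder (V × Bool) lt]
    (hlt : OrientsEdges Γ lt) (hab : Γ.Adj a.1 b.1)
    (hw : NormalWord Γ lt (letterInv a :: w)) (ha : AllAdj Γ a w) :
    insertLetter Γ lt a (insertLetter Γ lt b (letterInv a :: w)) = insertLetter Γ lt b w := by
  rcases insertLetter_cases Γ lt b (letterInv a) w with ⟨-, h⟩ | ⟨hb, hba⟩ | ⟨h₁, h₂⟩
  · exact (hab.ne (show (letterInv a).1 = (letterInv b).1 from congrArg Prod.fst h)).elim
  · have hb_eq : insertLetter Γ lt b w = b :: w :=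
      insertLetter_eq_cons (allAdj_cons.1 hb).2 fun d hd =>
        trans_of lt hba (hw.lt_of_front hd (ha d hd.mem))
    rw [insertLetter_of_lt hb hba, hb_eq,
      insertLetter_cons_of_lt hab.symm (hlt _ _ _ _ a.2 b.2 hab hba), insertLetter_of_cancel ha rfl]
  · rw [insertLetter_of_not h₁ h₂,
      insertLetter_of_cancel ((allAdj_insertLetter_iff hab.symm).2 ha) rfl]

theorem NormalWord.insertLetter_comm_of_lt [IsStrictOrder (V × Bool) lt]
    (hlt : OrientsEdges Γ lt) (hab : Γ.Adj a.1 b.1)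
    (h : lt a b) (hw : NormalWord Γ lt w) :
    insertLetter Γ lt b (insertLetter Γ lt a w) = insertLetter Γ lt a (insertLetter Γ lt b w) := by
  have hba := hab.symm
  induction w with
  | nil =>
    change insertLetter Γ lt b [a] = insertLetter Γ lt a [b]
    rw [insertLetter_of_lt (allAdj_singleton.2 hba) h, insertLetter_cons_of_lt hab h]
    rfl
  | cons c w ih =>
    rcases insertLetter_cases Γ lt a c w with ⟨ha, rfl⟩ | ha
    · rw [hw.insertLetter_comm_of_cancel hlt hab ha, insertLetter_of_cancel ha rfl]
    rcases insertLetter_cases Γ lt b c w with ⟨hb, rfl⟩ | hb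
    · rw [hw.insertLetter_comm_of_cancel hlt hba hb, insertLetter_of_cancel hb rfl]
    rcases ha with ⟨ha, hac⟩ | ⟨ha, hac⟩ <;> rcases hb with ⟨hb, hbc⟩ | ⟨hb, hbc⟩
    · rw [insertLetter_of_lt ha hac, insertLetter_of_lt hb hbc, insertLetter_cons_of_lt hab h,
        insertLetter_of_lt hb hbc, insertLetter_of_lt (allAdj_cons.2 ⟨hba, ha⟩) h]
    · have ha' : AllAdj Γ a (c :: insertLetter Γ lt b w) := by
        rwa [allAdj_cons, allAdj_insertLetter_iff hba, ← allAdj_cons]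
      rw [insertLetter_of_lt ha hac, insertLetter_cons_of_lt hab h, insertLetter_of_not hb hbc,
        insertLetter_of_lt ha' hac]
    · have hb' : AllAdj Γ b (c :: insertLetter Γ lt a w) := by
        rwa [allAdj_cons, allAdj_insertLetter_iff hab, ← allAdj_cons]
      rw [insertLetter_of_not ha hac, insertLetter_of_lt hb hbc, insertLetter_of_lt hb' hbc,
        insertLetter_of_not (fun h' => ne_letterInv_of_adj hba h'.2), insertLetter_of_not ha hac]
      exact fun h' => hac ⟨(allAdj_cons.1 h'.1).2, trans_of lt h hbc⟩
    · rw [insertLetter_of_not ha hac, insertLetter_of_not hb hbc, insertLetter_of_not,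
        insertLetter_of_not, ih hw.2]
      · rwa [allAdj_insertLetter_iff hba]
      · rwa [allAdj_cons, allAdj_insertLetter_iff hba, ← allAdj_cons]
      · rwa [allAdj_insertLetter_iff hab]
      · rwa [allAdj_cons, allAdj_insertLetter_iff hab, ← allAdj_cons]

theorem NormalWord.insertLetter_comm [IsStrictTotalOrder (V × Bool) lt]
    (hlt : OrientsEdges Γ lt) (hab : Γ.Adj a.1 b.1) (hw : NormalWord Γ lt w) :
    insertLetter Γ lt b (insertLetter Γ lt a w) = insertLetter Γ lt a (insertLetter Γ lt b w) := by
  rcases lt_or_lt_of_adj (lt := lt) hab with h | h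
  · exact hw.insertLetter_comm_of_lt hlt hab h
  · exact (hw.insertLetter_comm_of_lt hlt hab.symm h).symm

end InsertLetter

section Action

variable {V : Type*} {Γ : SimpleGraph V} {lt : V × Bool → V × Bool → Prop}

theorem value_nil : value Γ [] = 1 := rfl

theorem value_append (u v : List (V × Bool)) : value Γ (u ++ v) = value Γ u * value Γ v := by
  simp only [value, ← FreeGroup.mul_mk, map_mul]

theorem value_cons (a : V × Bool) (v : List (V × Bool)) :
    value Γ (a :: v) = value Γ [a] * value Γ v :=
  value_append [a] v

theorem value_letterInv (a : V × Bool) : value Γ [letterInv a] = (value Γ [a])⁻¹ := by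
  rw [value, value, ← map_inv, FreeGroup.inv_mk]
  rfl

variable [IsStrictTotalOrder (V × Bool) lt]

variable (Γ lt) in
/-- Right multiplication by a letter as a permutation of the normal words. -/
noncomputable def insertPerm (a : V × Bool) :
    Equiv.Perm {w : List (V × Bool) // NormalWord Γ lt w} where
  toFun w := ⟨insertLetter Γ lt a w.1, w.2.normalWord_insertLetter⟩
  invFun w := ⟨insertLetter Γ lt (letterInv a) w.1, w.2.normalWord_insertLetter⟩
  left_inv w := Subtype.ext (w.2.insertLetter_letterInv_insertLetter a)
  right_inv w := Subtype.ext <| by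
    simpa only [letterInv_letterInv] using w.2.insertLetter_letterInv_insertLetter (letterInv a)

theorem insertPerm_letterInv (a : V × Bool) :
    insertPerm Γ lt (letterInv a) = (insertPerm Γ lt a)⁻¹ :=
  Equiv.ext fun _ => rfl

theorem insertPerm_commute (hlt : OrientsEdges Γ lt) {a b : V × Bool} (hab : Γ.Adj a.1 b.1) :
    Commute (insertPerm Γ lt a) (insertPerm Γ lt b) :=
  Equiv.ext fun w => Subtype.ext (w.2.insertLetter_comm hlt hab.symm)

/-- The action of the right-angled Artin group by right multiplication on normal words. -/
noncomputable def normalAction (hlt : OrientsEdges Γ lt) :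
    Grp Γ →* (Equiv.Perm {w : List (V × Bool) // NormalWord Γ lt w})ᵐᵒᵖ :=
  PresentedGroup.toGroup (f := fun x => MulOpposite.op (insertPerm Γ lt (x, true))) <| by
    rintro _ ⟨x, y, h, rfl⟩
    have hcomm := (insertPerm_commute hlt (a := (x, true)) (b := (y, true)) h).op
    simp only [map_mul, map_inv, FreeGroup.lift_apply_of]
    rw [hcomm.eq, mul_inv_cancel_right, mul_inv_cancel]

theorem normalAction_value_singleton (hlt : OrientsEdges Γ lt) (a : V × Bool) :
    normalAction hlt (value Γ [a]) = MulOpposite.op (insertPerm Γ lt a) := by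
  have hgen (x : V) : normalAction hlt (value Γ [(x, true)]) =
      MulOpposite.op (insertPerm Γ lt (x, true)) := PresentedGroup.toGroup.of _
  rcases a with ⟨x, _ | _⟩
  · change normalAction hlt (value Γ [letterInv (x, true)]) =
      MulOpposite.op (insertPerm Γ lt (letterInv (x, true)))
    rw [value_letterInv, map_inv, hgen, insertPerm_letterInv, MulOpposite.op_inv]
  · exact hgen x

theorem normalAction_value_apply (hlt : OrientsEdges Γ lt) {w v : List (V × Bool)}
    (hv : NormalWord Γ lt v) (hvw : NormalWord Γ lt (v ++ w)) :
    (normalAction hlt (value Γ w)).unop ⟨v, hv⟩ = ⟨v ++ w, hvw⟩ := by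
  induction w generalizing v with
  | nil => simp [value_nil]
  | cons a w ih =>
    have hvaw : NormalWord Γ lt ((v ++ [a]) ++ w) := by rwa [List.append_cons] at hvw
    have hva := hvaw.of_append_left
    have hins : insertPerm Γ lt a ⟨v, hv⟩ = ⟨v ++ [a], hva⟩ :=
      Subtype.ext hva.insertLetter_eq_append
    rw [value_cons, map_mul, normalAction_value_singleton, MulOpposite.unop_mul,
      MulOpposite.unop_op, Equiv.Perm.mul_apply, hins, ih hva hvaw]
    simp

theorem NormalWord.eq_of_value_eq (hlt : OrientsEdges Γ lt) {w w' : List (V × Bool)}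
    (hw : NormalWord Γ lt w) (hw' : NormalWord Γ lt w') (h : value Γ w = value Γ w') :
    w = w' := by
  have hact := normalAction_value_apply hlt (v := []) trivial hw
  rw [h, normalAction_value_apply hlt (v := []) trivial hw'] at hact
  exact congrArg Subtype.val hact.symm

end Action

/-! ### The complete system -/

section ShiftRules

variable {V : Type*} {Γ : SimpleGraph V} {lt : V × Bool → V × Bool → Prop} {a b : V × Bool}
  {w : List (V × Bool)} {ρ : Rule (V × Bool)}

variable (Γ lt) in
/-- The rules `u x → x u` which satisfy the condition on prefixes and for which `u` is normal. -/
def shiftRules : Set (Rule (V × Bool)) :=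
  {ρ | ∃ (u : List (V × Bool)) (x : V × Bool), ρ = (u ++ [x], x :: u) ∧
    PrefixCondition (commRules Γ lt) u x ∧ NormalWord Γ lt u}

variable (Γ lt) in
/-- The system obtained by completion from the commutation rules and the rules of free reduction. -/
def completeRules : Set (Rule (V × Bool)) := shiftRules Γ lt ∪ freeRules V

theorem mem_commRules_iff : ([a, b], [b, a]) ∈ commRules Γ lt ↔ Γ.Adj a.1 b.1 ∧ lt b a := by
  constructor
  · rintro ⟨x, y, γ, ε, h, h', he⟩
    simp only [Prod.mk.injEq, List.cons.injEq, and_true] at he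
    obtain ⟨⟨rfl, rfl⟩, -⟩ := he
    exact ⟨h, h'⟩
  · exact fun h => ⟨a.1, b.1, a.2, b.2, h.1, h.2, rfl⟩

theorem length_of_mem_commRules (h : ρ ∈ commRules Γ lt) :
    ρ.1.length = 2 ∧ ρ.2.length = 2 := by
  obtain ⟨x, y, γ, ε, -, -, rfl⟩ := h
  exact ⟨rfl, rfl⟩

theorem length_of_mem_freeRules (h : ρ ∈ freeRules V) : ρ.1.length = 2 ∧ ρ.2.length = 0 := by
  obtain ⟨x, γ, rfl⟩ := h
  exact ⟨rfl, rfl⟩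

theorem mem_shiftRules_iff : ρ ∈ shiftRules Γ lt ↔
    ∃ (t : V × Bool) (ts : List (V × Bool)) (x : V × Bool), ρ = (t :: ts ++ [x], x :: t :: ts) ∧
      AllAdj Γ x (t :: ts) ∧ lt x t ∧ (∀ s ∈ ts, lt s x) ∧ NormalWord Γ lt (t :: ts) := by
  simp only [shiftRules, PrefixCondition, mem_commRules_iff, allAdj_cons, Set.mem_ofPred_eq]
  constructor
  · rintro ⟨_, x, rfl, ⟨t, ts, rfl, ht, hts⟩, hn⟩
    exact ⟨t, ts, x, rfl, ⟨ht.1, fun s hs => (hts s hs).1.symm⟩, ht.2, fun s hs => (hts s hs).2, hn⟩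
  · rintro ⟨t, ts, x, rfl, hadj, ht, hts, hn⟩
    exact ⟨_, x, rfl, ⟨t, ts, rfl, ⟨hadj.1, ht⟩, fun s hs => ⟨(hadj.2 s hs).symm, hts s hs⟩⟩, hn⟩

theorem commRules_subset_shiftRules : commRules Γ lt ⊆ shiftRules Γ lt := by
  rintro _ ⟨x, y, γ, ε, hxy, hlt, rfl⟩
  exact mem_shiftRules_iff.2 ⟨(x, γ), [], (y, ε), rfl, allAdj_singleton.2 hxy, hlt,
    fun _ h => absurd h List.not_mem_nil, normalWord_singleton _⟩

theorem mem_commRules_of_length_le (h : ρ ∈ shiftRules Γ lt) (hl : ρ.1.length ≤ 2) :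
    ρ ∈ commRules Γ lt := by
  obtain ⟨t, ts, x, rfl, hadj, hlt, -⟩ := mem_shiftRules_iff.1 h
  obtain rfl : ts = [] := by simpa using hl
  exact mem_commRules_iff.2 ⟨allAdj_singleton.1 hadj, hlt⟩

theorem perm_of_mem_shiftRules (h : ρ ∈ shiftRules Γ lt) : ρ.1.Perm ρ.2 := by
  obtain ⟨u, x, rfl, -⟩ := h
  exact List.perm_append_singleton x u

theorem shiftRules_disjoint_freeRules : Disjoint (shiftRules Γ lt) (freeRules V) :=
  Set.disjoint_left.2 fun ρ h h' => by
    have hshift := (perm_of_mem_shiftRules h).length_eq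
    have hfree := length_of_mem_freeRules h'
    omega

theorem two_le_length_of_mem_completeRules (h : ρ ∈ completeRules Γ lt) : 2 ≤ ρ.1.length := by
  rcases h with h | h
  · obtain ⟨t, ts, x, rfl, -⟩ := mem_shiftRules_iff.1 h
    simp
  · exact (length_of_mem_freeRules h).1.ge

theorem mem_shiftRules_of_three_le_length (h : ρ ∈ completeRules Γ lt) (hl : 3 ≤ ρ.1.length) :
    ρ ∈ shiftRules Γ lt :=
  h.resolve_right fun hf => by have := length_of_mem_freeRules hf; omega

theorem mem_shiftRules_of_length_le (h : ρ ∈ completeRules Γ lt)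
    (hl : ρ.1.length ≤ ρ.2.length) : ρ ∈ shiftRules Γ lt :=
  h.resolve_right fun hf => by have := length_of_mem_freeRules hf; omega

theorem truncation_completeRules_two :
    truncation (completeRules Γ lt) 2 = commRules Γ lt ∪ freeRules V := by
  ext ρ
  constructor
  · rintro ⟨h | h, hl⟩
    · exact .inl (mem_commRules_of_length_le h hl)
    · exact .inr h
  · rintro (h | h)
    · exact ⟨.inl (commRules_subset_shiftRules h), (length_of_mem_commRules h).1.le⟩
    · exact ⟨.inr h, (length_of_mem_freeRules h).1.le⟩

theorem shortlex_of_mem_completeRules (h : ρ ∈ completeRules Γ lt) :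
    List.Shortlex lt ρ.2 ρ.1 := by
  rcases h with h | h
  · have hl := (perm_of_mem_shiftRules h).length_eq
    obtain ⟨t, ts, x, rfl, -, hxt, -⟩ := mem_shiftRules_iff.1 h
    exact .of_lex hl.symm (.rel hxt)
  · have hl := length_of_mem_freeRules h
    exact .of_length_lt (by omega)

theorem subset_of_mem_completeRules (h : ρ ∈ completeRules Γ lt) : ρ.2 ⊆ ρ.1 := by
  rcases h with h | h
  · exact (perm_of_mem_shiftRules h).symm.subset
  · simp [List.length_eq_zero_iff.1 (length_of_mem_freeRules h).2]

theorem terminating_completeRules [IsStrictOrder (V × Bool) lt] :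
    Terminating (completeRules Γ lt) :=
  terminating_of_shortlex (fun _ => shortlex_of_mem_completeRules)
    fun _ => subset_of_mem_completeRules

theorem length_lt_or_perm_of_reducesStar {v : List (V × Bool)}
    (h : ReducesStar (completeRules Γ lt) w v) : v.length < w.length ∨ w.Perm v := by
  induction h with
  | refl => exact .inr (.refl _)
  | tail _ h ih =>
    obtain ⟨p, q, ρ, hρ | hρ, rfl, rfl⟩ := h
    · have hperm := ((perm_of_mem_shiftRules hρ).append_left p).append_right q
      exact ih.imp (hperm.length_eq ▸ ·) (·.trans hperm)
    · have hfree := length_of_mem_freeRules hρ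
      have hle := ih.elim le_of_lt fun h => h.length_eq.ge
      refine .inl (lt_of_lt_of_le ?_ hle)
      simp only [List.length_append]
      omega

end ShiftRules

section Presentation

variable {V : Type*} {Γ : SimpleGraph V} {lt : V × Bool → V × Bool → Prop} {a b x : V × Bool}
  {u w w' : List (V × Bool)}

theorem commute_value (h : Γ.Adj a.1 b.1) : Commute (value Γ [a]) (value Γ [b]) := by
  have hgen (x y : V) (h : Γ.Adj x y) : Commute (value Γ [(x, true)]) (value Γ [(y, true)]) := by
    have hrel := PresentedGroup.one_of_mem (rels := {c : FreeGroup V | ∃ x y, Γ.Adj x y ∧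
      c = FreeGroup.of x * FreeGroup.of y * (FreeGroup.of x)⁻¹ * (FreeGroup.of y)⁻¹})
      ⟨x, y, h, rfl⟩
    rwa [map_mul, map_mul, map_mul, map_inv, map_inv, mul_inv_eq_one, mul_inv_eq_iff_eq_mul]
      at hrel
  have hinv (x : V) : value Γ [(x, false)] = (value Γ [(x, true)])⁻¹ := value_letterInv (x, true)
  obtain ⟨x, γ⟩ := a
  obtain ⟨y, ε⟩ := b
  cases γ <;> cases ε <;> simpa [hinv] using hgen x y h

theorem value_eq_of_equivalent (h : Equivalent (commRules Γ lt ∪ freeRules V) w w') :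
    value Γ w = value Γ w' := by
  refine h.congr_invariant ?_
  rintro _ _ ⟨p, q, ρ, hρ, rfl, rfl⟩
  suffices hval : value Γ ρ.1 = value Γ ρ.2 by simp only [value_append, hval]
  rcases hρ with ⟨x, y, γ, ε, hadj, -, rfl⟩ | ⟨x, γ, rfl⟩
  · exact (commute_value (a := (x, γ)) (b := (y, ε)) hadj).eq
  · change value Γ [(x, γ), letterInv (x, γ)] = value Γ []
    rw [value_cons, value_letterInv, mul_inv_cancel, value_nil]

theorem AllAdj.equivalent [Std.Trichotomous lt] (h : AllAdj Γ x u) :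
    Equivalent (commRules Γ lt ∪ freeRules V) (u ++ [x]) (x :: u) := by
  induction u with
  | nil => exact .refl _
  | cons c u ih =>
    rw [allAdj_cons] at h
    have hcx : Equivalent (commRules Γ lt ∪ freeRules V) [c, x] [x, c] := by
      rcases lt_or_lt_of_adj (lt := lt) h.1 with hlt | hlt
      · exact (equivalent_of_mem (ρ := ([x, c], [c, x]))
          (.inl (mem_commRules_iff.2 ⟨h.1.symm, hlt⟩))).symm
      · exact equivalent_of_mem (ρ := ([c, x], [x, c])) (.inl (mem_commRules_iff.2 ⟨h.1, hlt⟩))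
    have hu := (ih h.2).append [c] []
    rw [List.append_nil, List.append_nil] at hu
    exact hu.trans _ _ _ (hcx.append [] u)

theorem equivalent_completeRules_iff [Std.Trichotomous lt] :
    Equivalent (completeRules Γ lt) w w' ↔ Equivalent (commRules Γ lt ∪ freeRules V) w w' := by
  refine ⟨.of_rules fun ρ hρ => ?_, .of_rules fun ρ hρ => ?_⟩
  · rcases hρ with h | h
    · obtain ⟨t, ts, x, rfl, hadj, -⟩ := mem_shiftRules_iff.1 h
      exact hadj.equivalent
    · exact equivalent_of_mem (.inr h)
  · exact equivalent_of_mem (hρ.imp_left fun h => commRules_subset_shiftRules h)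

theorem value_eq_of_reduces [Std.Trichotomous lt] (h : Reduces (completeRules Γ lt) w w') :
    value Γ w = value Γ w' :=
  value_eq_of_equivalent (equivalent_completeRules_iff.1 (.rel _ _ h))

end Presentation

section NormalForms

variable {V : Type*} {Γ : SimpleGraph V} {lt : V × Bool → V × Bool → Prop} {a c : V × Bool}
  {u w w' : List (V × Bool)} {ρ : Rule (V × Bool)}

theorem lt_of_normalWord_append_singleton (hu : AllAdj Γ a u)
    (hn : NormalWord Γ lt (u ++ [a])) : ∀ s ∈ u, lt s a := by
  induction u with
  | nil => exact fun _ h => absurd h List.not_mem_nil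
  | cons c u ih =>
    rw [allAdj_cons] at hu
    refine List.forall_mem_cons.2 ⟨hn.lt_of_front ?_ hu.1.symm, ih hu.2 hn.2⟩
    exact front_append.2 (.inr ⟨hu.2, front_cons_self a []⟩)

theorem normalWord_rhs_of_mem_completeRules [Std.Asymm lt] [IsTrans (V × Bool) lt]
    (h : ρ ∈ completeRules Γ lt) : NormalWord Γ lt ρ.2 := by
  rcases h with h | ⟨x, γ, rfl⟩
  · obtain ⟨t, ts, x, rfl, hadj, hxt, hts, hn⟩ := mem_shiftRules_iff.1 h
    refine ⟨fun b hb => ⟨ne_letterInv_of_adj (hadj b hb.mem), fun _ => ?_⟩, hn⟩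
    rcases hb with rfl | ⟨hbt, hb⟩
    · exact hxt
    · exact (asymm_of lt (trans_of lt (hts b hb.mem) hxt) (hn.lt_of_front hb hbt)).elim
  · trivial

theorem not_normalWord_lhs_of_mem_completeRules [Std.Asymm lt] (h : ρ ∈ completeRules Γ lt) :
    ¬ NormalWord Γ lt ρ.1 := by
  intro hn
  rcases h with h | ⟨x, γ, rfl⟩
  · obtain ⟨t, ts, x, rfl, hadj, hxt, -⟩ := mem_shiftRules_iff.1 h
    exact asymm_of lt hxt (lt_of_normalWord_append_singleton hadj hn t List.mem_cons_self)
  · exact hn.not_front_letterInv (front_cons_self _ _)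

theorem NormalWord.not_isInfix [Std.Asymm lt] (hw : NormalWord Γ lt w)
    (hρ : ρ ∈ completeRules Γ lt) : ¬ ρ.1 <:+: w := by
  rintro ⟨p, q, rfl⟩
  exact not_normalWord_lhs_of_mem_completeRules hρ hw.of_append_left.of_append_right

theorem mem_shiftRules_of_not_lt [Std.Trichotomous lt] (hadj : AllAdj Γ a (c :: u))
    (hca : ¬ lt c a) (hcu : NormalWord Γ lt (c :: u)) (hua : NormalWord Γ lt (u ++ [a])) :
    (c :: u ++ [a], a :: c :: u) ∈ shiftRules Γ lt :=
  mem_shiftRules_iff.2 ⟨c, u, a, rfl, hadj,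
    (lt_or_lt_of_adj (hadj c List.mem_cons_self)).resolve_left hca,
    lt_of_normalWord_append_singleton (allAdj_cons.1 hadj).2 hua, hcu⟩

/-- Unless `c` and its inverse are neighbours, the letter after `c` commutes with `c` and precedes
its inverse, hence precedes `c` itself. -/
theorem exists_isInfix_of_cancel (hlt : OrientsEdges Γ lt) (hu : AllAdj Γ (letterInv c) u)
    (hn : NormalWord Γ lt (u ++ [letterInv c])) :
    ∃ ρ ∈ completeRules Γ lt, ρ.1 <:+: c :: u ++ [letterInv c] := by
  cases u with
  | nil => exact ⟨([c, letterInv c], []), .inr ⟨c.1, c.2, rfl⟩, List.infix_rfl⟩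
  | cons d u =>
    have hcd : Γ.Adj c.1 d.1 := (hu d List.mem_cons_self).symm
    have hdc : lt d (letterInv c) := lt_of_normalWord_append_singleton hu hn d List.mem_cons_self
    have hmem : ([c, d], [d, c]) ∈ commRules Γ lt :=
      mem_commRules_iff.2 ⟨hcd, hlt _ _ _ _ c.2 d.2 hcd hdc⟩
    exact ⟨_, .inl (commRules_subset_shiftRules hmem), [], u ++ [letterInv c], by simp⟩

theorem normalWord_of_irreducible [Std.Trichotomous lt] (hlt : OrientsEdges Γ lt)
    (hw : Irreducible (completeRules Γ lt) w) : NormalWord Γ lt w := by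
  induction hn : w.length using Nat.strong_induction_on generalizing w with
  | _ n ih =>
    rw [irreducible_iff] at hw
    have hfactor {v : List (V × Bool)} (hv : v <:+: w) (hl : v.length < w.length) :
        NormalWord Γ lt v :=
      ih _ (hn ▸ hl) (irreducible_iff.2 fun ρ hρ hρv => hw ρ hρ (hρv.trans hv)) rfl
    obtain _ | ⟨c, w⟩ := w
    · trivial
    refine ⟨fun a ha => ?_, hfactor (List.suffix_cons c w).isInfix (by simp)⟩
    obtain ⟨u, v, rfl, hu⟩ := ha.exists_append
    have hprefix : c :: u ++ [a] <:+: c :: (u ++ a :: v) := ⟨[], v, by simp⟩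
    have hua : NormalWord Γ lt (u ++ [a]) := hfactor ⟨[c], v, by simp⟩ (by simp)
    constructor
    · rintro rfl
      obtain ⟨ρ, hρ, hinfix⟩ := exists_isInfix_of_cancel hlt hu hua
      exact hw ρ hρ (hinfix.trans hprefix)
    · intro hac
      have hcu : NormalWord Γ lt (c :: u) := hfactor ⟨[], a :: v, by simp⟩ (by simp)
      by_contra hca
      exact hw _ (.inl (mem_shiftRules_of_not_lt (allAdj_cons.2 ⟨hac.symm, hu⟩) hca hcu hua))
        hprefix

theorem exists_overlap_of_mem_shiftRules (hρ : ρ ∈ shiftRules Γ lt) (hl : 3 ≤ ρ.1.length) :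
    ∃ o : Overlap (V × Bool), o.IsIn (completeRules Γ lt) ∧ o.length = ρ.1.length ∧
      o.left.1.length + 1 = ρ.1.length ∧ o.crit₁ = ρ.2 ∧ o.crit₂ = ρ.1 := by
  obtain ⟨t, ts, x, rfl, hadj, hxt, hts, hn⟩ := mem_shiftRules_iff.1 hρ
  obtain rfl | ⟨us, y, rfl⟩ := ts.eq_nil_or_concat'
  · simp at hl
  have hleft : (t :: us ++ [x], x :: t :: us) ∈ shiftRules Γ lt :=
    mem_shiftRules_iff.2 ⟨t, us, x, rfl, fun s hs => hadj s (List.mem_append_left [y] hs), hxt,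
      fun s hs => hts s (List.mem_append_left [y] hs), NormalWord.of_append_left (q := [y]) hn⟩
  have hright : ([x, y], [y, x]) ∈ commRules Γ lt :=
    mem_commRules_iff.2 ⟨(hadj y (by simp)).symm, hts y (by simp)⟩
  exact ⟨⟨t :: us, [x], [y], x :: t :: us, [y, x]⟩,
    ⟨List.cons_ne_nil _ _, List.cons_ne_nil _ _, List.cons_ne_nil _ _, .inl hleft,
      .inl (commRules_subset_shiftRules hright)⟩,
    by simp [Overlap.length], by simp [Overlap.left], rfl, by simp [Overlap.crit₂]⟩

theorem irreducible_lhs_of_mem_shiftRules [Std.Asymm lt] (hρ : ρ ∈ shiftRules Γ lt)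
    {k : ℕ} (hk : k < ρ.1.length) : Irreducible (truncation (completeRules Γ lt) k) ρ.1 := by
  obtain ⟨t, ts, x, rfl, hadj, -, hts, hn⟩ := mem_shiftRules_iff.1 hρ
  have htail : NormalWord Γ lt (ts ++ [x]) := hn.2.append_singleton (allAdj_cons.1 hadj).2 hts
  refine irreducible_iff.2 fun σ hσ hinfix => ?_
  rcases List.infix_cons_iff.1 hinfix with h | h
  · rcases List.prefix_concat_iff.1 (show σ.1 <+: (t :: ts) ++ [x] from h) with h | h
    · exact hk.not_ge ((congrArg List.length h).ge.trans hσ.2)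
    · exact hn.not_isInfix hσ.1 h.isInfix
  · exact htail.not_isInfix hσ.1 h

variable [IsStrictTotalOrder (V × Bool) lt]

theorem eq_of_irreducible_of_value_eq (hlt : OrientsEdges Γ lt) (w w' : List (V × Bool))
    (hw : Irreducible (completeRules Γ lt) w) (hw' : Irreducible (completeRules Γ lt) w')
    (h : value Γ w = value Γ w') : w = w' :=
  (normalWord_of_irreducible hlt hw).eq_of_value_eq hlt (normalWord_of_irreducible hlt hw') h

theorem complete_completeRules (hlt : OrientsEdges Γ lt) : Complete (completeRules Γ lt) :=
  terminating_completeRules.complete_of_invariant (fun _ _ => value_eq_of_reduces)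
    (eq_of_irreducible_of_value_eq hlt)

theorem equivalent_completeRules_iff_value_eq (hlt : OrientsEdges Γ lt) :
    Equivalent (completeRules Γ lt) w w' ↔ value Γ w = value Γ w' :=
  terminating_completeRules.equivalent_iff_of_invariant (fun _ _ => value_eq_of_reduces)
    (eq_of_irreducible_of_value_eq hlt)

theorem lengthwiseGenerated_completeRules (hlt : OrientsEdges Γ lt) :
    LengthwiseGenerated lt (completeRules Γ lt) where
  shortlex _ := shortlex_of_mem_completeRules
  two_le_length _ := two_le_length_of_mem_completeRules
  eq_of_equivalent w w' hw hw' h := eq_of_irreducible_of_value_eq hlt w w' hw hw'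
    ((equivalent_completeRules_iff_value_eq hlt).1 h)
  irreducible_rhs ρ hρ := irreducible_iff.2 fun σ hσ =>
    (normalWord_rhs_of_mem_completeRules hρ).not_isInfix hσ
  irreducible_lhs ρ hρ k hk := by
    rcases hρ with hρ | hρ
    · exact irreducible_lhs_of_mem_shiftRules hρ hk
    · refine irreducible_iff.2 fun σ hσ _ => ?_
      have hlen := length_of_mem_freeRules hρ
      have htwo := two_le_length_of_mem_completeRules hσ.1
      have hσk := hσ.2
      omega
  lhs_eq l l' r hl hl' h h' := by
    obtain ⟨u, x, he, -⟩ := mem_shiftRules_of_three_le_length hl h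
    obtain ⟨u', x', he', -⟩ := mem_shiftRules_of_three_le_length hl' h'
    obtain ⟨rfl, rfl⟩ := Prod.mk.inj he
    obtain ⟨rfl, hr⟩ := Prod.mk.inj he'
    obtain ⟨rfl, rfl⟩ := List.cons.inj hr
    rfl
  exists_overlap ρ hρ hl :=
    exists_overlap_of_mem_shiftRules (mem_shiftRules_of_three_le_length hρ hl) hl

end NormalForms

/-! ### Overlaps which produce rules -/

section Completion

variable {V : Type*} {Γ : SimpleGraph V} {lt : V × Bool → V × Bool → Prop}
  {nf : Set (Rule (V × Bool)) → List (V × Bool) → List (V × Bool)} {S : Set (Rule (V × Bool))}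
  {o : Overlap (V × Bool)} {ρ : Rule (V × Bool)}

theorem head_eq_and_perm_of_cons_perm_cons {α : Type*} {r : α → α → Prop} [Std.Asymm r] {a b : α}
    {l m : List α} (h : (a :: l).Perm (b :: m)) (ha : ∀ x ∈ l, r x a) (hb : ∀ x ∈ m, r x b) :
    a = b ∧ l.Perm m := by
  obtain rfl : a = b := by
    by_contra hne
    have hal : r a b := hb a ((List.mem_cons.1 (h.mem_iff.1 List.mem_cons_self)).resolve_left hne)
    have hbm : r b a :=
      ha b ((List.mem_cons.1 (h.mem_iff.2 List.mem_cons_self)).resolve_left (Ne.symm hne))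
    exact asymm_of r hal hbm
  exact ⟨rfl, h.cons_inv⟩

/-- If the overlap `v` had a first letter `b` before its last letter `x`, then the left rule would
give `b < x`, and the right rule, whose last letter is `y`, would give `x < y < b`. -/
theorem exists_overlap_eq_singleton_of_isIn_shiftRules [IsStrictOrder (V × Bool) lt]
    (ho : o.IsIn (shiftRules Γ lt)) :
    ∃ t ts x ss y, o.u = t :: ts ∧ o.v = [x] ∧ o.w = ss ++ [y] ∧ lt x t ∧ (∀ s ∈ ts, lt s x) ∧
      lt y x ∧ (∀ s ∈ ss, lt s y) ∧ NormalWord Γ lt (x :: ss) := by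
  obtain ⟨u, v, w, r₁, r₂⟩ := o
  obtain ⟨hu, hv, hw, hleft, hright⟩ := ho
  obtain ⟨t, ts, x, hleft, -, hxt, hts, -⟩ := mem_shiftRules_iff.1 hleft
  obtain ⟨b, bs, y, hright, -, hyb, hbs, hn⟩ := mem_shiftRules_iff.1 hright
  obtain ⟨u₀, u, rfl⟩ := List.exists_cons_of_ne_nil hu
  obtain ⟨v, x', rfl⟩ := (List.eq_nil_or_concat' v).resolve_left hv
  obtain ⟨ss, y', rfl⟩ := (List.eq_nil_or_concat' w).resolve_left hw
  have huv : u₀ :: u ++ v ++ [x'] = t :: ts ++ [x] :=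
    (List.append_assoc _ _ _).trans (congrArg Prod.fst hleft)
  have hvw : v ++ [x'] ++ ss ++ [y'] = b :: bs ++ [y] :=
    (List.append_assoc _ _ _).trans (congrArg Prod.fst hright)
  obtain ⟨huv', rfl⟩ := List.append_singleton_inj.1 huv
  obtain ⟨hvw', rfl⟩ := List.append_singleton_inj.1 hvw
  obtain ⟨rfl, rfl⟩ := List.cons.inj huv'
  obtain _ | ⟨b', v⟩ := v
  · obtain ⟨rfl, rfl⟩ := List.cons.inj hvw'
    exact ⟨u₀, u, x', ss, y', rfl, rfl, rfl, hxt, by simpa using hts, hyb, hbs, hn⟩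
  · obtain ⟨rfl, rfl⟩ := List.cons.inj hvw'
    have hbx : lt b' x' := hts b' (by simp)
    have hxy : lt x' y' := hbs x' (by simp)
    exact (asymm_of lt hbx (trans_of lt hxy hyb)).elim

/-- After its first two letters, the letters of `ρ.1` commute with the second one, so that in the
normal word `x ss` the letters of `ss` would have to exceed `x`. -/
theorem right_mem_commRules_of_perm [IsStrictOrder (V × Bool) lt] (ho : o.IsIn (shiftRules Γ lt))
    (hρ : ρ ∈ shiftRules Γ lt) (hperm : (o.u ++ o.v ++ o.w).Perm ρ.1) :
    o.right ∈ commRules Γ lt := by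
  obtain ⟨t, ts, x, ss, y, hu, hv, hw, hxt, hts, hyx, hss, hn⟩ :=
    exists_overlap_eq_singleton_of_isIn_shiftRules ho
  obtain ⟨c, cs, z, rfl, hadj, hzc, hcs, -⟩ := mem_shiftRules_iff.1 hρ
  have hcons : (t :: x :: (ts ++ o.w)).Perm (c :: z :: cs) := calc
    (t :: x :: (ts ++ o.w)).Perm (t :: ts ++ [x] ++ o.w) :=
      .cons t ((List.perm_append_singleton x ts).symm.append_right o.w)
    _ = o.u ++ o.v ++ o.w := by rw [hu, hv]
    List.Perm _ (c :: cs ++ [z]) := hperm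
    List.Perm _ (c :: z :: cs) := .cons c (List.perm_append_singleton z cs)
  have hrest : ∀ s ∈ ts ++ o.w, lt s x := by
    simp only [hw, List.mem_append, List.mem_singleton]
    rintro s (h | h | rfl)
    exacts [hts s h, trans_of lt (hss s h) hyx, hyx]
  obtain ⟨rfl, htail⟩ := head_eq_and_perm_of_cons_perm_cons hcons
    (List.forall_mem_cons.2 ⟨hxt, fun s hs => trans_of lt (hrest s hs) hxt⟩)
    (List.forall_mem_cons.2 ⟨hzc, fun s hs => trans_of lt (hcs s hs) hzc⟩)
  obtain ⟨rfl, hmem⟩ := head_eq_and_perm_of_cons_perm_cons htail hrest hcs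
  obtain _ | ⟨s, ss⟩ := ss
  · exact mem_commRules_of_length_le ho.right_mem (by simp [Overlap.right, hv, hw])
  · have hsw : s ∈ ts ++ o.w := by simp [hw]
    have hxs : lt x s := hn.lt_of_front (front_cons_self s ss)
      (hadj s (List.mem_cons_of_mem t (hmem.mem_iff.1 hsw)))
    exact (asymm_of lt hxs (hrest s hsw)).elim

/-- If the overlap involves free reduction, or if a reduction shortens the overlapped word, then
one of the normal forms is too short to be a side of `ρ`. -/
theorem mem_and_mem_of_produces [IsStrictOrder (V × Bool) lt]
    (hnf : ∀ w, ReducesStar (completeRules Γ lt) w (nf S w)) (ho : o.IsIn (completeRules Γ lt))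
    (hρ : ρ ∈ shiftRules Γ lt) (hl : o.length ≤ ρ.1.length) (h : Produces lt nf S o ρ) :
    o.left ∈ shiftRules Γ lt ∧ o.right ∈ commRules Γ lt := by
  have hperm := perm_of_mem_shiftRules hρ
  have hword (c : List (V × Bool)) (hc : nf S c = ρ.1 ∨ nf S c = ρ.2)
      (hred : Reduces (completeRules Γ lt) (o.u ++ o.v ++ o.w) c) :
      o.length ≤ c.length ∧ (o.u ++ o.v ++ o.w).Perm ρ.1 := by
    have hnfc : (nf S c).Perm ρ.1 := hc.elim (fun h => .of_eq h) fun h => h ▸ hperm.symm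
    have hle : o.length ≤ (nf S c).length := hl.trans hnfc.length_eq.ge
    refine ⟨hle.trans ?_, ?_⟩
    · exact (length_lt_or_perm_of_reducesStar (hnf c)).elim le_of_lt fun h => h.length_eq.ge
    · exact ((length_lt_or_perm_of_reducesStar (.head hred (hnf c))).resolve_left
        hle.not_gt).trans hnfc
  have hcrit : (nf S o.crit₁ = ρ.1 ∨ nf S o.crit₁ = ρ.2) ∧
      (nf S o.crit₂ = ρ.1 ∨ nf S o.crit₂ = ρ.2) := by
    rcases h.2 with rfl | rfl <;> simp
  obtain ⟨hl₁, hρword⟩ := hword _ hcrit.1 ho.reduces_crit₁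
  obtain ⟨hl₂, -⟩ := hword _ hcrit.2 ho.reduces_crit₂
  have hleft : o.left ∈ shiftRules Γ lt := mem_shiftRules_of_length_le ho.left_mem <| by
    rw [o.length_eq_left_add, Overlap.crit₁, List.length_append] at hl₁
    exact Nat.le_of_add_le_add_right hl₁
  have hright : o.right ∈ shiftRules Γ lt := mem_shiftRules_of_length_le ho.right_mem <| by
    rw [o.length_eq_add_right, Overlap.crit₂, List.length_append] at hl₂
    exact Nat.le_of_add_le_add_left hl₂
  exact ⟨hleft, right_mem_commRules_of_perm ⟨ho.1, ho.2.1, ho.2.2.1, hleft, hright⟩ hρ hρword⟩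

variable [IsStrictTotalOrder (V × Bool) lt] {k : ℕ} {s : State (V × Bool)}

theorem mem_and_mem_of_mem_next (hlt : OrientsEdges Γ lt) (hnf : IsNormalizer lt nf)
    (hs : StateInvariant (completeRules Γ lt) k s) (ho : o ∈ s.next)
    (hρ : Produces lt nf s.rules o ρ) : o.left ∈ shiftRules Γ lt ∧ o.right ∈ commRules Γ lt := by
  have hT := lengthwiseGenerated_completeRules hlt
  obtain ⟨hρT, hl⟩ := hs.mem_of_produces hT hnf ho hρ
  have hol := hs.length_of_produces hT hnf ho hρ
  rw [hs.rules_eq] at hρ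
  exact mem_and_mem_of_produces
    (fun w => (hT.reducesStar_nf hnf k w).mono truncation_subset)
    ((hs.isIn_truncation ho).mono truncation_subset)
    (mem_shiftRules_of_three_le_length hρT (hl.symm ▸ Nat.succ_le_succ hs.two_le))
    (hol.trans hl.symm).le hρ

theorem length_of_mem_newRules (hlt : OrientsEdges Γ lt) (hnf : IsNormalizer lt nf)
    (hs : StateInvariant (completeRules Γ lt) k s) (hρ : ρ ∈ s.newRules lt nf) :
    ρ.1.length = k + 1 ∧ ρ.2.length = k + 1 := by
  rw [hs.newRules_eq (lengthwiseGenerated_completeRules hlt) hnf] at hρ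
  obtain ⟨hρT, hl⟩ := hρ
  have hperm := perm_of_mem_shiftRules <|
    mem_shiftRules_of_three_le_length hρT (hl.symm ▸ Nat.succ_le_succ hs.two_le)
  exact ⟨hl, hperm.length_eq.symm.trans hl⟩

theorem resolves_of_mem_next (hlt : OrientsEdges Γ lt) (hnf : IsNormalizer lt nf)
    (hs : StateInvariant (completeRules Γ lt) k s) (ho : o ∈ s.next)
    (h : ¬ (o.left ∈ shiftRules Γ lt ∧ o.right ∈ commRules Γ lt)) : o.Resolves s.rules := by
  have hnfs (w : List (V × Bool)) : ReducesStar s.rules w (nf s.rules w) := by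
    rw [hs.rules_eq]
    exact (lengthwiseGenerated_completeRules hlt).reducesStar_nf hnf k w
  refine (o.resolves_or_exists_produces (lt := lt) hnfs).resolve_right ?_
  exact fun ⟨_, hρ⟩ => h (mem_and_mem_of_mem_next hlt hnf hs ho hρ)

theorem completion_eq_completeRules (hlt : OrientsEdges Γ lt) (hnf : IsNormalizer lt nf) :
    completion lt nf (commRules Γ lt ∪ freeRules V) = completeRules Γ lt := by
  rw [← truncation_completeRules_two, (lengthwiseGenerated_completeRules hlt).completion_eq hnf]

theorem completion_sdiff_freeRules (hlt : OrientsEdges Γ lt) (hnf : IsNormalizer lt nf) :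
    completion lt nf (commRules Γ lt ∪ freeRules V) \ freeRules V = shiftRules Γ lt := by
  rw [completion_eq_completeRules hlt hnf, completeRules, Set.union_sdiff_right,
    shiftRules_disjoint_freeRules.sdiff_eq_left]

theorem stateInvariant_run_commRules (hlt : OrientsEdges Γ lt) (hnf : IsNormalizer lt nf) (n : ℕ) :
    StateInvariant (completeRules Γ lt) (n + 2) (run lt nf (commRules Γ lt ∪ freeRules V) n) := by
  rw [← truncation_completeRules_two]
  exact (lengthwiseGenerated_completeRules hlt).stateInvariant_run hnf n

theorem exists_mem_next_of_isIn_completeRules (hlt : OrientsEdges Γ lt) (hnf : IsNormalizer lt nf)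
    (ho : o.IsIn (completeRules Γ lt)) :
    ∃ n, o ∈ (run lt nf (commRules Γ lt ∪ freeRules V) n).next := by
  rw [← truncation_completeRules_two]
  exact (lengthwiseGenerated_completeRules hlt).exists_mem_next hnf ho

end Completion

section Positivity

variable {V : Type*} {Γ : SimpleGraph V} {lt : V × Bool → V × Bool → Prop}
  {ρ : Rule (V × Bool)} {S : Set (Rule (V × Bool))}

theorem positive_iff_of_mem_shiftRules (h : ρ ∈ shiftRules Γ lt) :
    Positive ρ.1 ↔ Positive ρ.2 :=
  forall_congr' fun _ => imp_congr_left (perm_of_mem_shiftRules h).mem_iff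

theorem positive_rhs_of_mem_completeRules (h : ρ ∈ completeRules Γ lt) (hρ : Positive ρ.1) :
    Positive ρ.2 :=
  fun a ha => hρ a (subset_of_mem_completeRules h ha)

theorem exists_positive_mem_commRules [Std.Trichotomous lt] (h : ∃ x y, Γ.Adj x y) :
    ∃ ρ ∈ commRules Γ lt, Positive ρ.1 := by
  have hpos (x y : V) : Positive [(x, true), (y, true)] := by simp [Positive]
  obtain ⟨x, y, h⟩ := h
  rcases lt_or_lt_of_adj (lt := lt) (a := (x, true)) (b := (y, true)) h with hlt | hlt
  · exact ⟨_, mem_commRules_iff.2 ⟨h.symm, hlt⟩, hpos y x⟩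
  · exact ⟨_, mem_commRules_iff.2 ⟨h, hlt⟩, hpos x y⟩

theorem conditionCPlus_of_subset [Std.Trichotomous lt] (hcomm : commRules Γ lt ⊆ S)
    (hS : S ⊆ completeRules Γ lt) (h : ∃ x y, Γ.Adj x y) : ConditionCPlus S := by
  obtain ⟨ρ, hρ, hpos⟩ := exists_positive_mem_commRules (lt := lt) h
  exact ⟨⟨ρ, hcomm hρ, hpos⟩, fun _ hρ => positive_rhs_of_mem_completeRules (hS hρ)⟩

end Positivity

end RightAngledArtin

open KnuthBendix RightAngledArtin in
theorem proposition4p6_general {V : Type*} (Γ : SimpleGraph V)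
    (lt : V × Bool → V × Bool → Prop) [IsStrictTotalOrder (V × Bool) lt]
    (hlt : OrientsEdges Γ lt)
    (nf : Set (Rule (V × Bool)) → List (V × Bool) → List (V × Bool))
    (hnf : IsNormalizer lt nf)
    (F R₀ R : Set (Rule (V × Bool))) (s : ℕ → State (V × Bool))
    (hF : F = freeRules V) (hR₀ : R₀ = commRules Γ lt)
    (hs : s = run lt nf (R₀ ∪ F)) (hR : R = completion lt nf (R₀ ∪ F) \ F) :
    (Complete (R ∪ F) ∧
      (∀ w w', Equivalent (R ∪ F) w w' ↔ Equivalent (R₀ ∪ F) w w') ∧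
      (∀ w w', Equivalent (R ∪ F) w w' ↔ value Γ w = value Γ w')) ∧
    (∀ ρ ∈ R, ∃ (u : List (V × Bool)) (x : V × Bool),
      ρ = (u ++ [x], x :: u) ∧ PrefixCondition R₀ u x) ∧
    ((∀ o : Overlap (V × Bool), o.IsIn (R ∪ F) → ∃ n, o ∈ (s n).next) ∧
      (∀ n, ∀ o ∈ (s n).next, ∀ ρ, Produces lt nf (s n).rules o ρ →
        o.left ∈ R ∧ o.right ∈ R₀) ∧
      (∀ n, ∀ o ∈ (s n).next, ¬ (o.left ∈ R ∧ o.right ∈ R₀) →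
        o.Resolves (s n).rules)) ∧
    ((∀ ρ ∈ R₀, ρ.1.length = 2 ∧ ρ.2.length = 2) ∧
      (∀ n, ∀ ρ ∈ (s n).newRules lt nf,
        ρ.1.length = (n + 1) + 2 ∧ ρ.2.length = (n + 1) + 2)) ∧
    ((∀ ρ ∈ R, Positive ρ.1 ↔ Positive ρ.2) ∧
      ((∃ x y, Γ.Adj x y) → ConditionCPlus R ∧ ConditionCPlus (R ∪ F))) := by
  have hRshift : R = shiftRules Γ lt := by rw [hR, hR₀, hF, completion_sdiff_freeRules hlt hnf]
  have hRF : R ∪ F = completeRules Γ lt := by rw [hRshift, hF, completeRules]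
  have hrun (n : ℕ) : StateInvariant (completeRules Γ lt) (n + 2) (s n) := by
    rw [hs, hR₀, hF]
    exact stateInvariant_run_commRules hlt hnf n
  have htreated (o : Overlap (V × Bool)) (ho : o.IsIn (completeRules Γ lt)) :
      ∃ n, o ∈ (s n).next := by
    rw [hs, hR₀, hF]
    exact exists_mem_next_of_isIn_completeRules hlt hnf ho
  rw [hRF, hRshift, hR₀, hF]
  exact ⟨⟨complete_completeRules hlt, fun _ _ => equivalent_completeRules_iff,
      fun _ _ => equivalent_completeRules_iff_value_eq hlt⟩,
    fun ρ ⟨u, x, hρ, hprefix, _⟩ => ⟨u, x, hρ, hprefix⟩,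
    ⟨htreated, fun n _ ho _ => mem_and_mem_of_mem_next hlt hnf (hrun n) ho,
      fun n _ => resolves_of_mem_next hlt hnf (hrun n)⟩,
    ⟨fun _ => length_of_mem_commRules, fun n _ => length_of_mem_newRules hlt hnf (hrun n)⟩,
    fun _ => positive_iff_of_mem_shiftRules, fun hedge =>
      ⟨conditionCPlus_of_subset commRules_subset_shiftRules Set.subset_union_left hedge,
        conditionCPlus_of_subset (commRules_subset_shiftRules.trans Set.subset_union_left)
          subset_rfl hedge⟩⟩

open KnuthBendix RightAngledArtin in
theorem proposition4p6 {V : Type*} [Finite V] (Γ : SimpleGraph V)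
    (lt : V × Bool → V × Bool → Prop) [IsStrictTotalOrder (V × Bool) lt]
    (hlt : OrientsEdges Γ lt)
    (nf : Set (Rule (V × Bool)) → List (V × Bool) → List (V × Bool))
    (hnf : IsNormalizer lt nf)
    (F R₀ R : Set (Rule (V × Bool))) (s : ℕ → State (V × Bool))
    (hF : F = freeRules V) (hR₀ : R₀ = commRules Γ lt)
    (hs : s = run lt nf (R₀ ∪ F)) (hR : R = completion lt nf (R₀ ∪ F) \ F) :
    -- the completed system is complete, equivalent to the initial one, and presents the group
    (Complete (R ∪ F) ∧
      (∀ w w', Equivalent (R ∪ F) w w' ↔ Equivalent (R₀ ∪ F) w w') ∧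
      (∀ w w', Equivalent (R ∪ F) w w' ↔ value Γ w = value Γ w')) ∧
    -- (A)
    (∀ ρ ∈ R, ∃ (u : List (V × Bool)) (x : V × Bool),
      ρ = (u ++ [x], x :: u) ∧ PrefixCondition R₀ u x) ∧
    -- (B)
    ((∀ o : Overlap (V × Bool), o.IsIn (R ∪ F) → ∃ n, o ∈ (s n).next) ∧
      (∀ n, ∀ o ∈ (s n).next, ∀ ρ, Produces lt nf (s n).rules o ρ →
        o.left ∈ R ∧ o.right ∈ R₀) ∧
      (∀ n, ∀ o ∈ (s n).next, ¬ (o.left ∈ R ∧ o.right ∈ R₀) →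
        o.Resolves (s n).rules)) ∧
    -- (C)
    ((∀ ρ ∈ R₀, ρ.1.length = 2 ∧ ρ.2.length = 2) ∧
      (∀ n, ∀ ρ ∈ (s n).newRules lt nf,
        ρ.1.length = (n + 1) + 2 ∧ ρ.2.length = (n + 1) + 2)) ∧
    -- (ii)
    ((∀ ρ ∈ R, Positive ρ.1 ↔ Positive ρ.2) ∧
      ((∃ x y, Γ.Adj x y) → ConditionCPlus R ∧ ConditionCPlus (R ∪ F))) :=
  proposition4p6_general Γ lt hlt nf hnf F R₀ R s hF hR₀ hs hR
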